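/- Let $\kappa\in\mathbb R$ and let $M_\kappa^2$ be the model surface of constant curvature $\kappa$ (a round sphere of radius $1/\sqrt\kappa$ if $\kappa>0$, the Euclidean plane if $\kappa=0$, the hyperbolic plane with metric rescaled by $1/\sqrt{-\kappa}$ if $\kappa<0$). A triangle is a nondegenerate labelled geodesic triangle $ABC$ in $M_\kappa^2$ (its vertices are not on one geodesic line and, if $\kappa>0$, lie in a common open hemisphere), with sides $a=BC$, $b=CA$, $c=AB$. Let $D,E,F$ be the midpoints of $BC,CA,AB$. The medial subdivision of $ABC$ consists of the four triangles $DEF$, $AFE$, $FBD$, $EDC$, whose vertices, in the order listed, are again labelled $A,B,C$ (so each side keeps the letter of the side containing it or, if there is none, of the side it is parallel to, i.e. does not meet). For $DEF$ and $AFE$ the new side $a$ is $EF$; we say that it is obtained as the parallel side of the old side $a$. A sequence $t_0,t_1,\dots$ of triangles is nested if $t_{n+1}$ is one of the four triangles of the medial subdivision of $t_n$ for every $n\ge 0$. Let $h_n$ be the height of $t_n$ from its vertex $A$, that is, the minimal distance from $A$ to the complete geodesic (great circle if $\kappa>0$) containing the side $a=BC$ of $t_n$. Then to each triangle $t_0$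 in $M_\kappa^2$ one can assign constants $l_h=l_h(t_0)>0$ and $L_h=L_h(t_0)>0$ such that: 1. for every nested sequence $t_0,t_1,\dots$ starting at $t_0$ and every $n\in\mathbb N$, $$h_0\cdot l_h\ \le\ 2^n h_n\ \le\ h_0\cdot L_h ;$$ 2. if moreover there is some $m\in\mathbb N$ for which the side $a$ of $t_{m+1}$ is obtained as the parallel side of the side $a$ of $t_m$, then both inequalities are strict for every $n\in\mathbb N$; 3. $l_h(t_0)\to1$ from below and $L_h(t_0)\to 1$ from above as all the side lengths of $t_0$ tend to $0$. -/

import Mathlib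

open Filter Topology

noncomputable section

namespace MedialSubdivision

/-- The bilinear form `x₀ y₀ + κ (x₁ y₁ + x₂ y₂)` on `ℝ³`. -/
def form (κ : ℝ) (x y : Fin 3 → ℝ) : ℝ :=
  x 0 * y 0 + κ * (x 1 * y 1 + x 2 * y 2)

/-- The model surface `M_κ²` of constant curvature `κ`: the quadric `x₀² + κ (x₁² + x₂²) = 1`,
restricted to the sheet `x₀ > 0` when `κ ≤ 0`.
* For `κ > 0` the map `x ↦ (x₀ / √κ, x₁, x₂)` identifies it with the round sphere of radius `1 / √κ`.
* For `κ = 0` it is the plane `x₀ = 1`.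
* For `κ < 0` the map `x ↦ (x₀, √(-κ) x₁, √(-κ) x₂)` identifies it with the hyperboloid model of
  the hyperbolic plane (with the metric rescaled by `1 / √(-κ)`). -/
def ModelPlane (κ : ℝ) : Type :=
  {x : Fin 3 → ℝ // form κ x x = 1 ∧ (κ ≤ 0 → 0 < x 0)}

variable {κ : ℝ}

/-- The underlying vector of `ℝ³`. -/
def ModelPlane.vec (p : ModelPlane κ) : Fin 3 → ℝ := p.1

/-- The geodesic distance of `M_κ²`: `cos (√κ d) = form κ p q` for `κ > 0`, the Euclidean distance
for `κ = 0`, and `cosh (√(-κ) d) = form κ p q` for `κ < 0`. -/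
def gdist (p q : ModelPlane κ) : ℝ :=
  if 0 < κ then Real.arccos (form κ p.vec q.vec) / √κ
  else if κ < 0 then Real.arcosh (form κ p.vec q.vec) / √(-κ)
  else √((p.vec 1 - q.vec 1) ^ 2 + (p.vec 2 - q.vec 2) ^ 2)

/-- `m` is a midpoint of the minimal geodesic segment from `p` to `q`. -/
def IsMidpoint (m p q : ModelPlane κ) : Prop :=
  gdist p m = gdist p q / 2 ∧ gdist m q = gdist p q / 2

/-- The complete geodesic (great circle for `κ > 0`) through two distinct, non-antipodal points:
the intersection of the surface with the linear plane that they span. -/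
def geodesicLine (p q : ModelPlane κ) : Set (ModelPlane κ) :=
  {x | x.vec ∈ Submodule.span ℝ {p.vec, q.vec}}

/-- The height of a point over a set: its minimal distance to the points of the set. -/
def heightOver (p : ModelPlane κ) (s : Set (ModelPlane κ)) : ℝ :=
  sInf (gdist p '' s)

/-- A labelled nondegenerate geodesic triangle `ABC`: the vertices do not lie on one geodesic line,
and for `κ > 0` they lie in a common open hemisphere. -/
structure Triangle (κ : ℝ) where
  A : ModelPlane κ
  B : ModelPlane κ
  C : ModelPlane κ
  nondegenerate : LinearIndependent ℝ ![A.vec, B.vec, C.vec]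
  hemisphere : 0 < κ → ∃ u : Fin 3 → ℝ, 0 < u ⬝ᵥ A.vec ∧ 0 < u ⬝ᵥ B.vec ∧ 0 < u ⬝ᵥ C.vec

namespace Triangle

/-- Length of the side `BC`, opposite `A`. -/
def a (T : Triangle κ) : ℝ := gdist T.B T.C

/-- Length of the side `CA`, opposite `B`. -/
def b (T : Triangle κ) : ℝ := gdist T.C T.A

/-- Length of the side `AB`, opposite `C`. -/
def c (T : Triangle κ) : ℝ := gdist T.A T.B

/-- The height from the vertex `A` onto the line prolonging the opposite side `BC`. -/
def height (T : Triangle κ) : ℝ := heightOver T.A (geodesicLine T.B T.C)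

/-- The largest side length. -/
def maxSide (T : Triangle κ) : ℝ := max T.a (max T.b T.c)

end Triangle

/-- The four triangles of the medial subdivision of `ABC`: the innermost one, and the outer ones
at the vertices `A`, `B`, `C`. -/
inductive Piece
  | inner
  | outerA
  | outerB
  | outerC

/-- `T` is the given triangle of the medial subdivision of `S`, labelled so that each side of `T`
carries the letter of the side of `S` that contains it or, if there is none, of the side of `S` to
which it is parallel, i.e. which it does not meet. Here `D`, `E`, `F` are the midpoints of the sides
`BC`, `CA`, `AB` of `S`. -/
def IsMedialPiece (k : Piece) (S T : Triangle κ) : Prop :=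
  ∃ D E F : ModelPlane κ,
    IsMidpoint D S.B S.C ∧ IsMidpoint E S.C S.A ∧ IsMidpoint F S.A S.B ∧
    match k with
    | .inner => T.A = D ∧ T.B = E ∧ T.C = F
    | .outerA => T.A = S.A ∧ T.B = F ∧ T.C = E
    | .outerB => T.A = F ∧ T.B = S.B ∧ T.C = D
    | .outerC => T.A = E ∧ T.B = D ∧ T.C = S.C

/-- A sequence of nested triangles: each one belongs to the medial subdivision of the previous. -/
def IsNested (t : ℕ → Triangle κ) : Prop :=
  ∀ n, ∃ k, IsMedialPiece k (t n) (t (n + 1))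

/-- The side `a` of `T` is obtained as the parallel side of the side `a` of `S`, i.e. it is the
segment joining the midpoints of the other two sides of `S`. -/
def ParallelSideA (S T : Triangle κ) : Prop :=
  IsMedialPiece .inner S T ∨ IsMedialPiece .outerA S T

/-- The filter on triangles describing "all the side lengths tend to `0`". -/
def sidesToZero (κ : ℝ) : Filter (Triangle κ) := comap Triangle.maxSide (𝓝 0)

end MedialSubdivision

end

/-! For κ ≠ 0 a triangle is encoded by its `Shape`, the cosines (hyperbolic cosines for κ < 0) x, y,
z of its rescaled sides. The vertices have Gram determinant `gram`, and `hsq = gram / (1 - x²)` is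
the squared sine (minus the squared hyperbolic sine) of the rescaled height. Midpoints are
normalized sums, so the shape of each medial piece is explicit, and `exists_ratio` shows that 4
times the new `hsq` is the old one up to a factor in [μ², μ⁻²], where μ is governed by the half
sides.

If the `defect`, the largest distance of x, y, z from 1, also halves at each step, the logarithms of
these factors are dominated by a geometric series, and their product lies in [exp(-4d), exp(4d)] for
the initial defect d (`pow_mul_mem_exp_bounds`). The defect halves for all hyperbolic triangles and
for spherical ones of defect at most 1. Comparing sine with angle costs another exponential factor
and yields `sharp_of_neg` and `sharp_of_pos`.

A large spherical triangle is projected centrally to a plane. Segments stay segments, and midpoints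
become points dividing them in ratios bounded by the least value m of the hemisphere functional at
the vertices, so the projected diameter contracts by a fixed factor. After a number of steps
depending only on the initial triangle the pieces are small, and each earlier step costs only a
bounded factor (`coarse_of_pos`).

In the Euclidean plane heights halve exactly. In all cases `exists_distortion` adds a little slack
to the constants, which makes the inequalities strict and the limits one-sided. -/

noncomputable section

namespace MedialSubdivision

/-! ### Shapes of medial pieces: Gram determinants and height ratios -/

/-- The half-angle map: if `x` is the form of two points, `halfCos x` is the form of either of them
with their midpoint. -/
def halfCos (x : ℝ) : ℝ := √((1 + x) / 2)

theorem halfCos_pos {x : ℝ} (hx : -1 < x) : 0 < halfCos x :=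
  Real.sqrt_pos.2 (by linarith)

theorem halfCos_sq {x : ℝ} (hx : -1 < x) : halfCos x ^ 2 = (1 + x) / 2 :=
  Real.sq_sqrt (by linarith)

/-- The values of the form on the three pairs of vertices `BC`, `CA`, `AB` of a triangle. -/
structure Shape where
  x : ℝ
  y : ℝ
  z : ℝ

/-- The value of the form on the midpoints of the sides belonging to `y` and `z`. -/
def midForm (x y z : ℝ) : ℝ := (1 + x + y + z) / (4 * halfCos y * halfCos z)

namespace Shape

/-- The Gram determinant of the three vertices. -/
def gram (s : Shape) : ℝ := 1 + 2 * s.x * s.y * s.z - s.x ^ 2 - s.y ^ 2 - s.z ^ 2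

/-- For `κ > 0` the squared sine, for `κ < 0` minus the squared hyperbolic sine of the
(rescaled) height. -/
def hsq (s : Shape) : ℝ := s.gram / (1 - s.x ^ 2)

/-- A measure for the size of the triangle. -/
def defect (s : Shape) : ℝ := max |1 - s.x| (max |1 - s.y| |1 - s.z|)

/-- The shape of a triangle of the medial subdivision. -/
def child (s : Shape) : Piece → Shape
  | .inner => ⟨midForm s.x s.y s.z, midForm s.y s.z s.x, midForm s.z s.x s.y⟩
  | .outerA => ⟨midForm s.x s.y s.z, halfCos s.y, halfCos s.z⟩
  | .outerB => ⟨halfCos s.x, midForm s.y s.z s.x, halfCos s.z⟩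
  | .outerC => ⟨halfCos s.x, halfCos s.y, midForm s.z s.x s.y⟩

/-- The shapes of nondegenerate spherical triangles. -/
structure Spherical (s : Shape) : Prop where
  gram_pos : 0 < s.gram
  x_gt : -1 < s.x
  x_lt : s.x < 1
  y_gt : -1 < s.y
  y_lt : s.y < 1
  z_gt : -1 < s.z
  z_lt : s.z < 1

/-- The shapes of nondegenerate hyperbolic triangles. -/
structure Hyperbolic (s : Shape) : Prop where
  gram_pos : 0 < s.gram
  x_gt : 1 < s.x
  y_gt : 1 < s.y
  z_gt : 1 < s.z

/-- `4 (1 + y) (1 + z) (1 - v²)`, where `v` is the form of the midpoints of the sides `y`, `z`. -/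
def midDenom (s : Shape) : ℝ := 4 * (1 + s.y) * (1 + s.z) - (1 + s.x + s.y + s.z) ^ 2

/-- This form and `midDenom_eq'` bound `midDenom` from opposite sides: here `gram > 0` is dropped,
there a sum of terms that are nonnegative whenever `1 - x`, `1 - y`, `1 - z` share a sign. -/
theorem midDenom_eq (s : Shape) :
    s.midDenom = 2 * (1 - s.x) * (1 + s.y) * (1 + s.z) + s.gram := by
  simp only [midDenom, gram]; ring

theorem midDenom_eq' (s : Shape) :
    s.midDenom = 8 * (1 - s.x) - (1 - s.x) ^ 2 - 2 * (1 - s.x) * (1 - s.y + (1 - s.z))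
      - (s.y - s.z) ^ 2 := by
  simp only [midDenom]; ring

theorem one_sub_midForm_sq (s : Shape) (hy : -1 < s.y) (hz : -1 < s.z) :
    1 - midForm s.x s.y s.z ^ 2 = s.midDenom / (4 * (1 + s.y) * (1 + s.z)) := by
  have h1 : 1 + s.y ≠ 0 := by linarith
  have h2 : 1 + s.z ≠ 0 := by linarith
  rw [midForm, div_pow, mul_pow, mul_pow, halfCos_sq hy, halfCos_sq hz, midDenom]
  field_simp
  ring

/-- `gram` is a squared volume. Replacing B, C by (A + B)/(2r) and (C + A)/(2q), with q, r the
half-angle cosines of y, z, divides the volume by 4qr. -/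
theorem gram_child_outerA (s : Shape) (hy : -1 < s.y) (hz : -1 < s.z) :
    (s.child .outerA).gram = s.gram / (4 * (1 + s.y) * (1 + s.z)) := by
  have hq := (halfCos_pos hy).ne'
  have hr := (halfCos_pos hz).ne'
  have hq2 := halfCos_sq hy
  have hr2 := halfCos_sq hz
  have h1 : 1 + s.y ≠ 0 := by linarith
  have h2 : 1 + s.z ≠ 0 := by linarith
  simp only [child, gram, midForm, div_pow, mul_pow, hq2, hr2]
  field_simp
  ring

theorem gram_child_outerB (s : Shape) (hx : -1 < s.x) (hz : -1 < s.z) :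
    (s.child .outerB).gram = s.gram / (4 * (1 + s.x) * (1 + s.z)) := by
  have hq := (halfCos_pos hx).ne'
  have hr := (halfCos_pos hz).ne'
  have hq2 := halfCos_sq hx
  have hr2 := halfCos_sq hz
  have h1 : 1 + s.x ≠ 0 := by linarith
  have h2 : 1 + s.z ≠ 0 := by linarith
  simp only [child, gram, midForm, div_pow, mul_pow, hq2, hr2]
  field_simp
  ring

theorem gram_child_outerC (s : Shape) (hx : -1 < s.x) (hy : -1 < s.y) :
    (s.child .outerC).gram = s.gram / (4 * (1 + s.x) * (1 + s.y)) := by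
  have hq := (halfCos_pos hx).ne'
  have hr := (halfCos_pos hy).ne'
  have hq2 := halfCos_sq hx
  have hr2 := halfCos_sq hy
  have h1 : 1 + s.x ≠ 0 := by linarith
  have h2 : 1 + s.y ≠ 0 := by linarith
  simp only [child, gram, midForm, div_pow, mul_pow, hq2, hr2]
  field_simp
  ring

/-- The sums B + C, C + A, A + B span twice the volume of A, B, C; normalizing them divides it by
8pqr, with p, q, r the half-angle cosines. -/
theorem gram_child_inner (s : Shape) (hx : -1 < s.x) (hy : -1 < s.y) (hz : -1 < s.z) :
    (s.child .inner).gram = s.gram / (2 * (1 + s.x) * (1 + s.y) * (1 + s.z)) := by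
  have hp := (halfCos_pos hx).ne'
  have hq := (halfCos_pos hy).ne'
  have hr := (halfCos_pos hz).ne'
  have hp2 := halfCos_sq hx
  have hq2 := halfCos_sq hy
  have hr2 := halfCos_sq hz
  have h0 : 1 + s.x ≠ 0 := by linarith
  have h1 : 1 + s.y ≠ 0 := by linarith
  have h2 : 1 + s.z ≠ 0 := by linarith
  -- In the product of the three values every square root occurs twice, so the product is rational
  -- in x, y, z.
  have e : midForm s.x s.y s.z * midForm s.y s.z s.x * midForm s.z s.x s.y =
      (1 + s.x + s.y + s.z) ^ 3 / (8 * (1 + s.x) * (1 + s.y) * (1 + s.z)) := by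
    have : midForm s.x s.y s.z * midForm s.y s.z s.x * midForm s.z s.x s.y =
      (1 + s.x + s.y + s.z) ^ 3 / (64 * halfCos s.x ^ 2 * halfCos s.y ^ 2 * halfCos s.z ^ 2) := by
      simp only [midForm]
      field_simp
      ring
    rw [this, hp2, hq2, hr2]
    field_simp
    ring
  have e' : (s.child .inner).gram = 1 + 2 * (midForm s.x s.y s.z * midForm s.y s.z s.x *
      midForm s.z s.x s.y) - midForm s.x s.y s.z ^ 2 - midForm s.y s.z s.x ^ 2 -
      midForm s.z s.x s.y ^ 2 := by
    simp only [child, gram]; ring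
  rw [e', e]
  simp only [gram, midForm, div_pow, mul_pow, hp2, hq2, hr2]
  field_simp
  ring

theorem hsq_child_outerA (s : Shape) (hy : -1 < s.y) (hz : -1 < s.z) (hD : s.midDenom ≠ 0) :
    (s.child .outerA).hsq = s.gram / s.midDenom := by
  have h1 : 1 + s.y ≠ 0 := by linarith
  have h2 : 1 + s.z ≠ 0 := by linarith
  rw [hsq, gram_child_outerA s hy hz]
  simp only [child]
  rw [one_sub_midForm_sq s hy hz]
  field_simp

theorem hsq_child_inner (s : Shape) (hx : -1 < s.x) (hy : -1 < s.y) (hz : -1 < s.z)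
    (hD : s.midDenom ≠ 0) :
    (s.child .inner).hsq = s.gram / s.midDenom / ((1 + s.x) / 2) := by
  have h0 : 1 + s.x ≠ 0 := by linarith
  have h1 : 1 + s.y ≠ 0 := by linarith
  have h2 : 1 + s.z ≠ 0 := by linarith
  rw [hsq, gram_child_inner s hx hy hz]
  simp only [child]
  rw [one_sub_midForm_sq s hy hz]
  field_simp
  ring

/-- In spherical terms sin h = sin c · sin B. The piece keeps the angle at B and halves c, so sin h
is divided by 2 cos(c/2). -/
theorem hsq_child_outerB (s : Shape) (hx : -1 < s.x) (hz : -1 < s.z) (h1 : s.x ≠ 1) :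
    4 * (s.child .outerB).hsq = ((1 + s.z) / 2)⁻¹ * s.hsq := by
  have h0 : 1 + s.x ≠ 0 := by linarith
  have h2 : 1 + s.z ≠ 0 := by linarith
  have h3 : 1 - s.x ≠ 0 := fun h => h1 (by linarith)
  have h4 : 1 - s.x ^ 2 = (1 - s.x) * (1 + s.x) := by ring
  have h5 : 1 - (1 + s.x) / 2 = (1 - s.x) / 2 := by ring
  rw [hsq, gram_child_outerB s hx hz, hsq, h4]
  simp only [child]
  rw [halfCos_sq hx, h5]
  field_simp

theorem hsq_child_outerC (s : Shape) (hx : -1 < s.x) (hy : -1 < s.y) (h1 : s.x ≠ 1) :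
    4 * (s.child .outerC).hsq = ((1 + s.y) / 2)⁻¹ * s.hsq := by
  have h0 : 1 + s.x ≠ 0 := by linarith
  have h2 : 1 + s.y ≠ 0 := by linarith
  have h3 : 1 - s.x ≠ 0 := fun h => h1 (by linarith)
  have h4 : 1 - s.x ^ 2 = (1 - s.x) * (1 + s.x) := by ring
  have h5 : 1 - (1 + s.x) / 2 = (1 - s.x) / 2 := by ring
  rw [hsq, gram_child_outerC s hx hy, hsq, h4]
  simp only [child]
  rw [halfCos_sq hx, h5]
  field_simp

/-- For spherical triangles the height is halved by a medial subdivision up to a factor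
controlled by the cosines of the half sides. -/
theorem Spherical.exists_ratio {s : Shape} (hs : s.Spherical) {μ : ℝ} (h0 : 0 < μ)
    (hx : μ ≤ (1 + s.x) / 2) (hy : μ ≤ (1 + s.y) / 2) (hz : μ ≤ (1 + s.z) / 2) (k : Piece) :
    ∃ ρ, 4 * (s.child k).hsq = ρ * s.hsq ∧ μ ^ 2 ≤ ρ ∧ ρ * μ ^ 2 ≤ 1 := by
  obtain ⟨hG, hx1, hx2, hy1, hy2, hz1, hz2⟩ := hs
  have hμ : μ ≤ 1 := by linarith
  have hμ2 : μ ^ 2 ≤ μ := by nlinarith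
  have hα : 0 < 1 - s.x := by linarith
  have hα' : 0 < 1 + s.x := by linarith
  have hβ' : 0 < 1 + s.y := by linarith
  have hγ' : 0 < 1 + s.z := by linarith
  have hyz : μ ^ 2 * 4 ≤ (1 + s.y) * (1 + s.z) := by nlinarith
  have hD1 : 2 * (1 - s.x) * ((1 + s.y) * (1 + s.z)) ≤ s.midDenom := by
    rw [midDenom_eq]; linarith
  have hD0 : 0 < s.midDenom := lt_of_lt_of_le (by positivity) hD1
  have hD2 : s.midDenom ≤ 8 * (1 - s.x) := by
    rw [midDenom_eq']
    nlinarith [sq_nonneg (1 - s.x), sq_nonneg (s.y - s.z),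
      mul_pos hα (show 0 < 1 - s.y + (1 - s.z) by linarith)]
  have e4 : 1 - s.x ^ 2 = (1 - s.x) * (1 + s.x) := by ring
  have hA1 : (1 + s.x) / 2 ≤ 4 * ((1 - s.x) * (1 + s.x)) / s.midDenom := by
    rw [div_le_div_iff₀ (by norm_num) hD0]
    nlinarith
  have hA2 : 4 * ((1 - s.x) * (1 + s.x)) / s.midDenom * μ ^ 2 ≤ (1 + s.x) / 2 := by
    rw [div_mul_eq_mul_div, div_le_div_iff₀ hD0 (by norm_num)]
    have := mul_le_mul_of_nonneg_left hyz (show 0 ≤ 2 * (1 - s.x) * (1 + s.x) by positivity)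
    nlinarith
  have hB : ∀ t : ℝ, μ ≤ (1 + t) / 2 → t < 1 →
      μ ^ 2 ≤ ((1 + t) / 2)⁻¹ ∧ ((1 + t) / 2)⁻¹ * μ ^ 2 ≤ 1 := by
    intro t ht ht1
    have : 0 < (1 + t) / 2 := by linarith
    constructor
    · rw [le_inv_comm₀ (by positivity) this]
      have : 1 ≤ (μ ^ 2)⁻¹ := (one_le_inv₀ (by positivity)).2 (by linarith)
      linarith
    · rw [inv_mul_le_iff₀ this]; linarith
  cases k with
  | outerA =>
    refine ⟨4 * ((1 - s.x) * (1 + s.x)) / s.midDenom, ?_, by linarith, by linarith⟩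
    rw [hsq_child_outerA s hy1 hz1 hD0.ne', hsq, e4]
    field_simp
  | inner =>
    refine ⟨4 * ((1 - s.x) * (1 + s.x)) / s.midDenom / ((1 + s.x) / 2), ?_, ?_, ?_⟩
    · rw [hsq_child_inner s hx1 hy1 hz1 hD0.ne', hsq, e4]
      field_simp
    · rw [le_div_iff₀ (by linarith)]
      refine le_trans ?_ hA1
      exact mul_le_of_le_one_left (by linarith) (by linarith)
    · rw [div_mul_eq_mul_div, div_le_one (by linarith)]
      exact hA2
  | outerB => exact ⟨_, hsq_child_outerB s hx1 hz1 hx2.ne, hB _ hz hz2⟩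
  | outerC => exact ⟨_, hsq_child_outerC s hx1 hy1 hx2.ne, hB _ hy hy2⟩

/-- For hyperbolic triangles the height is halved by a medial subdivision up to a factor
controlled by the hyperbolic cosines of the half sides. -/
theorem Hyperbolic.exists_ratio {s : Shape} (hs : s.Hyperbolic) {μ : ℝ} (h0 : 0 < μ)
    (hx : μ * ((1 + s.x) / 2) ≤ 1) (hy : μ * ((1 + s.y) / 2) ≤ 1)
    (hz : μ * ((1 + s.z) / 2) ≤ 1) (k : Piece) :
    ∃ ρ, 4 * (s.child k).hsq = ρ * s.hsq ∧ μ ^ 2 ≤ ρ ∧ ρ * μ ^ 2 ≤ 1 := by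
  obtain ⟨hG, hx2, hy2, hz2⟩ := hs
  have hx1 : -1 < s.x := by linarith
  have hy1 : -1 < s.y := by linarith
  have hz1 : -1 < s.z := by linarith
  have hμ : μ ≤ 1 := by nlinarith
  have hμ2 : μ ^ 2 ≤ μ := by nlinarith
  have hα : 0 < s.x - 1 := by linarith
  have hα' : 0 < 1 + s.x := by linarith
  have hβ' : 0 < 1 + s.y := by linarith
  have hγ' : 0 < 1 + s.z := by linarith
  have hyz : μ ^ 2 * ((1 + s.y) * (1 + s.z)) ≤ 4 := by
    have := mul_le_mul hy hz (by positivity) zero_le_one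
    nlinarith
  have hD1 : -s.midDenom ≤ 2 * (s.x - 1) * ((1 + s.y) * (1 + s.z)) := by
    rw [midDenom_eq]; linarith
  have hD2 : 8 * (s.x - 1) ≤ -s.midDenom := by
    rw [midDenom_eq']
    nlinarith [sq_nonneg (1 - s.x), sq_nonneg (s.y - s.z),
      mul_pos hα (show 0 < s.y - 1 + (s.z - 1) by linarith)]
  have hD0 : 0 < -s.midDenom := by linarith
  have hD : s.midDenom ≠ 0 := by linarith
  have hxx : 1 - s.x ≠ 0 := by linarith
  have e4 : 1 - s.x ^ 2 = (1 - s.x) * (1 + s.x) := by ring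
  have hA1 : μ ^ 2 * ((1 + s.x) / 2) ≤ 4 * ((s.x - 1) * (1 + s.x)) / -s.midDenom := by
    rw [le_div_iff₀ hD0]
    have := mul_le_mul_of_nonneg_left hyz (show 0 ≤ (s.x - 1) * (1 + s.x) by positivity)
    have := mul_le_mul_of_nonneg_left hD1 (show 0 ≤ μ ^ 2 * ((1 + s.x) / 2) by positivity)
    nlinarith
  have hA2 : 4 * ((s.x - 1) * (1 + s.x)) / -s.midDenom ≤ (1 + s.x) / 2 := by
    rw [div_le_div_iff₀ hD0 (by norm_num)]
    nlinarith
  have hB : ∀ t : ℝ, μ * ((1 + t) / 2) ≤ 1 → 1 < t →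
      μ ^ 2 ≤ ((1 + t) / 2)⁻¹ ∧ ((1 + t) / 2)⁻¹ * μ ^ 2 ≤ 1 := by
    intro t ht ht1
    have : 0 < (1 + t) / 2 := by linarith
    constructor
    · have : μ ≤ ((1 + t) / 2)⁻¹ := by rwa [← one_div, le_div_iff₀ this]
      linarith
    · rw [inv_mul_le_iff₀ this]; linarith
  have hsq' : s.hsq = -(s.gram / ((s.x - 1) * (1 + s.x))) := by
    rw [hsq, e4, ← neg_sub s.x 1, neg_mul, div_neg]
  cases k with
  | outerA =>
    refine ⟨4 * ((s.x - 1) * (1 + s.x)) / -s.midDenom, ?_, ?_, ?_⟩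
    · rw [hsq_child_outerA s hy1 hz1 hD, hsq']
      field_simp
    · refine le_trans ?_ hA1
      exact le_mul_of_one_le_right (by positivity) (by linarith)
    · refine le_trans (mul_le_mul_of_nonneg_right hA2 (by positivity)) ?_
      nlinarith
  | inner =>
    refine ⟨4 * ((s.x - 1) * (1 + s.x)) / -s.midDenom / ((1 + s.x) / 2), ?_, ?_, ?_⟩
    · rw [hsq_child_inner s hx1 hy1 hz1 hD, hsq']
      field_simp
    · rw [le_div_iff₀ (by linarith)]
      exact hA1
    · rw [div_mul_eq_mul_div, div_le_one (by linarith)]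
      refine le_trans ?_ hA2
      exact mul_le_of_le_one_right (by positivity) (by linarith)
  | outerB => exact ⟨_, hsq_child_outerB s hx1 hz1 hx2.ne', hB _ hz hz2⟩
  | outerC => exact ⟨_, hsq_child_outerC s hx1 hy1 hx2.ne', hB _ hy hy2⟩

end Shape

/-! ### Halving of the defect -/

theorem abs_one_sub_halfCos_le {x : ℝ} (hx : -1 < x) : |1 - halfCos x| ≤ |1 - x| / 2 := by
  have h1 := halfCos_pos hx
  have h2 := halfCos_sq hx
  have : 1 - x = 2 * (1 + halfCos x) * (1 - halfCos x) := by linear_combination 2 * h2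
  rw [this, abs_mul, abs_of_pos (show 0 < 2 * (1 + halfCos x) by positivity)]
  nlinarith [abs_nonneg (1 - halfCos x)]

theorem one_sub_midForm {x y z : ℝ} (hy : -1 < y) (hz : -1 < z) :
    1 - midForm x y z =
      (1 - x - 2 * (halfCos y - halfCos z) ^ 2) / (4 * halfCos y * halfCos z) := by
  have h1 := halfCos_pos hy
  have h2 := halfCos_pos hz
  have h3 := halfCos_sq hy
  have h4 := halfCos_sq hz
  rw [midForm, eq_div_iff (by positivity), sub_mul, div_mul_cancel₀ _ (by positivity)]
  linear_combination 2 * h3 + 2 * h4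

/-- In `one_sub_midForm` the square only decreases the nonnegative left side, and `y, z ≥ 0` makes
the denominator at least 2. -/
theorem abs_one_sub_midForm_le_of_le_one {x y z : ℝ} (hy : 0 ≤ y) (hz : 0 ≤ z)
    (h : midForm x y z ≤ 1) : |1 - midForm x y z| ≤ |1 - x| / 2 := by
  have h1 := halfCos_pos (show -1 < y by linarith)
  have h2 := halfCos_pos (show -1 < z by linarith)
  have h3 := halfCos_sq (show -1 < y by linarith)
  have h4 := halfCos_sq (show -1 < z by linarith)
  have h5 : 2 ≤ 4 * halfCos y * halfCos z := by
    have : (1 / 2) ^ 2 ≤ (halfCos y * halfCos z) ^ 2 := by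
      rw [mul_pow, h3, h4]; nlinarith
    have := le_of_sq_le_sq this (by positivity)
    linarith
  rw [abs_of_nonneg (by linarith)]
  have h6 : (1 - midForm x y z) * (4 * halfCos y * halfCos z) ≤ |1 - x| := by
    rw [one_sub_midForm (by linarith) (by linarith), div_mul_cancel₀ _ (by positivity)]
    nlinarith [le_abs_self (1 - x), sq_nonneg (halfCos y - halfCos z)]
  nlinarith

/-- The square in `one_sub_midForm` now works against the estimate, but twice it is at most |y - z|
≤ d; the denominator is at least 4, which leaves (d + d)/4. -/
theorem abs_one_sub_midForm_le_of_one_le {x y z d : ℝ} (hy : 1 ≤ y) (hz : 1 ≤ z)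
    (hxd : |1 - x| ≤ d) (hyd : |1 - y| ≤ d) (hzd : |1 - z| ≤ d) :
    |1 - midForm x y z| ≤ d / 2 := by
  have h1 := halfCos_pos (show -1 < y by linarith)
  have h2 := halfCos_pos (show -1 < z by linarith)
  have h3 := halfCos_sq (show -1 < y by linarith)
  have h4 := halfCos_sq (show -1 < z by linarith)
  have h5 : 4 ≤ 4 * halfCos y * halfCos z := by
    have : 1 ^ 2 ≤ (halfCos y * halfCos z) ^ 2 := by
      rw [mul_pow, h3, h4]; nlinarith
    have := le_of_sq_le_sq this (by positivity)
    linarith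
  have h6 : 2 * (halfCos y - halfCos z) ^ 2 ≤ d := by
    rw [abs_le] at hyd hzd
    rcases le_total (halfCos y) (halfCos z) with h | h
    · nlinarith [mul_nonneg h1.le (sub_nonneg.2 h)]
    · nlinarith [mul_nonneg h2.le (sub_nonneg.2 h)]
  have h7 := sq_nonneg (halfCos y - halfCos z)
  have h8 : 0 ≤ d := (abs_nonneg _).trans hxd
  rw [one_sub_midForm (by linarith) (by linarith), abs_div,
    abs_of_pos (show 0 < 4 * halfCos y * halfCos z by positivity), div_le_iff₀ (by positivity)]
  rw [abs_le] at hxd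
  rw [abs_le]
  constructor <;> nlinarith

namespace Shape

theorem abs_one_sub_x_le (s : Shape) : |1 - s.x| ≤ s.defect := le_max_left _ _

theorem abs_one_sub_y_le (s : Shape) : |1 - s.y| ≤ s.defect :=
  (le_max_left _ _).trans (le_max_right _ _)

theorem abs_one_sub_z_le (s : Shape) : |1 - s.z| ≤ s.defect :=
  (le_max_right _ _).trans (le_max_right _ _)

theorem defect_nonneg (s : Shape) : 0 ≤ s.defect := (abs_nonneg _).trans s.abs_one_sub_x_le

/-- Defect at most 1 means that all form values are nonnegative; sphericity of the piece keeps its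
midline values at most 1. -/
theorem Spherical.defect_child_le {s : Shape} (hs : s.Spherical) (hd : s.defect ≤ 1) {k : Piece}
    (hk : (s.child k).Spherical) : (s.child k).defect ≤ s.defect / 2 := by
  have hx := s.abs_one_sub_x_le
  have hy := s.abs_one_sub_y_le
  have hz := s.abs_one_sub_z_le
  have hx0 : 0 ≤ s.x := by linarith [le_abs_self (1 - s.x)]
  have hy0 : 0 ≤ s.y := by linarith [le_abs_self (1 - s.y)]
  have hz0 : 0 ≤ s.z := by linarith [le_abs_self (1 - s.z)]
  have h1 := abs_one_sub_halfCos_le hs.x_gt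
  have h2 := abs_one_sub_halfCos_le hs.y_gt
  have h3 := abs_one_sub_halfCos_le hs.z_gt
  have h4 := abs_one_sub_midForm_le_of_le_one (x := s.x) hy0 hz0
  have h5 := abs_one_sub_midForm_le_of_le_one (x := s.y) hz0 hx0
  have h6 := abs_one_sub_midForm_le_of_le_one (x := s.z) hx0 hy0
  have hkx := hk.x_lt.le
  have hky := hk.y_lt.le
  have hkz := hk.z_lt.le
  refine max_le ?_ (max_le ?_ ?_) <;> cases k <;> simp only [child] at * <;> grind

theorem Hyperbolic.defect_child_le {s : Shape} (hs : s.Hyperbolic) (k : Piece) :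
    (s.child k).defect ≤ s.defect / 2 := by
  have hx := s.abs_one_sub_x_le
  have hy := s.abs_one_sub_y_le
  have hz := s.abs_one_sub_z_le
  have h1 := abs_one_sub_halfCos_le (show -1 < s.x by linarith [hs.x_gt])
  have h2 := abs_one_sub_halfCos_le (show -1 < s.y by linarith [hs.y_gt])
  have h3 := abs_one_sub_halfCos_le (show -1 < s.z by linarith [hs.z_gt])
  have h4 := abs_one_sub_midForm_le_of_one_le hs.y_gt.le hs.z_gt.le hx hy hz
  have h5 := abs_one_sub_midForm_le_of_one_le hs.z_gt.le hs.x_gt.le hy hz hx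
  have h6 := abs_one_sub_midForm_le_of_one_le hs.x_gt.le hs.y_gt.le hz hx hy
  refine max_le ?_ (max_le ?_ ?_) <;> cases k <;> simp only [child] <;> linarith

end Shape

/-! ### Accumulated error for small triangles -/

/-- If the error of each halving step decays geometrically, the total error is bounded. -/
theorem pow_mul_mem_exp_bounds (n : ℕ) : ∀ (a d : ℕ → ℝ), (∀ n, 0 ≤ a n) →
    (∀ n, ∃ ρ, 4 * a (n + 1) = ρ * a n ∧ Real.exp (-(2 * d n)) ≤ ρ ∧ ρ ≤ Real.exp (2 * d n)) →
    (∀ n, 0 ≤ d n) → (∀ n, d (n + 1) ≤ d n / 2) →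
    Real.exp (-(4 * d 0)) * a 0 ≤ 4 ^ n * a n ∧ 4 ^ n * a n ≤ Real.exp (4 * d 0) * a 0 := by
  induction n with
  | zero =>
    intro a d ha h hd0 hd
    have := hd0 0
    simp only [pow_zero, one_mul]
    exact ⟨mul_le_of_le_one_left (ha 0) (Real.exp_le_one_iff.2 (by linarith)),
      le_mul_of_one_le_left (ha 0) (Real.one_le_exp (by linarith))⟩
  | succ n ih =>
    intro a d ha h hd0 hd
    -- The induction splits off the first step and shifts the sequences; it closes because 4 d₁ + 2
    -- d₀ ≤ 4 d₀.
    obtain ⟨h1, h2⟩ := ih (fun n => a (n + 1)) (fun n => d (n + 1)) (fun n => ha _)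
      (fun n => h _) (fun n => hd0 _) (fun n => hd _)
    obtain ⟨ρ, h3, h4, h5⟩ := h 0
    have hd' := hd 0
    simp only [zero_add] at h1 h2 h3 h4 h5 hd'
    have e : (4 : ℝ) ^ (n + 1) * a (n + 1) = 4 * (4 ^ n * a (n + 1)) := by ring
    rw [e]
    constructor
    · calc Real.exp (-(4 * d 0)) * a 0
          ≤ Real.exp (-(4 * d 1)) * Real.exp (-(2 * d 0)) * a 0 := by
            rw [← Real.exp_add]
            exact mul_le_mul_of_nonneg_right (Real.exp_le_exp.2 (by linarith)) (ha 0)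
        _ ≤ Real.exp (-(4 * d 1)) * (ρ * a 0) := by
            rw [mul_assoc]
            exact mul_le_mul_of_nonneg_left (mul_le_mul_of_nonneg_right h4 (ha 0))
              (Real.exp_pos _).le
        _ ≤ 4 * (4 ^ n * a (n + 1)) := by rw [← h3]; linarith
    · calc 4 * (4 ^ n * a (n + 1)) ≤ Real.exp (4 * d 1) * (ρ * a 0) := by rw [← h3]; linarith
        _ ≤ Real.exp (4 * d 1) * Real.exp (2 * d 0) * a 0 := by
            rw [mul_assoc]
            exact mul_le_mul_of_nonneg_left (mul_le_mul_of_nonneg_right h5 (ha 0))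
              (Real.exp_pos _).le
        _ ≤ Real.exp (4 * d 0) * a 0 := by
            rw [← Real.exp_add]
            exact mul_le_mul_of_nonneg_right (Real.exp_le_exp.2 (by linarith)) (ha 0)

/-- With x the defect, this makes exp(-x) an admissible μ in `Spherical.exists_ratio`, since (1 +
cos)/2 ≥ 1 - x/2. -/
theorem exp_neg_le_one_sub_half {x : ℝ} (h0 : 0 ≤ x) (h1 : x ≤ 1) :
    Real.exp (-x) ≤ 1 - x / 2 := by
  rw [Real.exp_neg, inv_le_comm₀ (Real.exp_pos x) (by linarith)]
  refine le_trans ?_ (Real.add_one_le_exp x)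
  rw [inv_le_iff_one_le_mul₀ (by linarith)]
  nlinarith

theorem bounds_of_mul_exp {ρ d : ℝ} (h1 : Real.exp (-d) ^ 2 ≤ ρ) (h2 : ρ * Real.exp (-d) ^ 2 ≤ 1) :
    Real.exp (-(2 * d)) ≤ ρ ∧ ρ ≤ Real.exp (2 * d) := by
  have e : Real.exp (-d) ^ 2 = Real.exp (-(2 * d)) := by
    rw [← Real.exp_nat_mul]; congr 1; push_cast; ring
  rw [e] at h1 h2
  refine ⟨h1, ?_⟩
  rwa [Real.exp_neg, ← div_eq_mul_inv, div_le_one (Real.exp_pos _)] at h2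

theorem antitone_of_le_half {d : ℕ → ℝ} (h0 : ∀ n, 0 ≤ d n) (h : ∀ n, d (n + 1) ≤ d n / 2) :
    Antitone d :=
  antitone_nat_of_succ_le fun n => by linarith [h n, h0 n]

/-- A sequence of shapes of nested triangles. -/
def IsNestedShape (s : ℕ → Shape) : Prop := ∀ n, ∃ k, s (n + 1) = (s n).child k

theorem IsNestedShape.hyperbolic_bounds {s : ℕ → Shape} (hn : IsNestedShape s)
    (hs : ∀ n, (s n).Hyperbolic) (n : ℕ) :
    (s n).defect ≤ (s 0).defect ∧
    Real.exp (-(4 * (s 0).defect)) * -(s 0).hsq ≤ 4 ^ n * -(s n).hsq ∧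
    4 ^ n * -(s n).hsq ≤ Real.exp (4 * (s 0).defect) * -(s 0).hsq := by
  have hd : ∀ n, (s (n + 1)).defect ≤ (s n).defect / 2 := fun n => by
    obtain ⟨k, hk⟩ := hn n
    rw [hk]; exact (hs n).defect_child_le k
  refine ⟨antitone_of_le_half (fun n => (s n).defect_nonneg) hd (Nat.zero_le n), ?_⟩
  refine pow_mul_mem_exp_bounds n (fun n => -(s n).hsq) (fun n => (s n).defect) ?_ ?_
    (fun n => (s n).defect_nonneg) hd
  · intro n
    have := (hs n).x_gt
    rw [neg_nonneg]
    exact div_nonpos_of_nonneg_of_nonpos (hs n).gram_pos.le (by nlinarith)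
  · intro n
    obtain ⟨k, hk⟩ := hn n
    have key : ∀ x : ℝ, |1 - x| ≤ (s n).defect →
        Real.exp (-(s n).defect) * ((1 + x) / 2) ≤ 1 := by
      intro x hx
      rw [Real.exp_neg, inv_mul_le_iff₀ (Real.exp_pos _)]
      rw [abs_le] at hx
      linarith [Real.add_one_le_exp (s n).defect, (s n).defect_nonneg]
    obtain ⟨ρ, h1, h2, h3⟩ := (hs n).exists_ratio (Real.exp_pos (-(s n).defect))
      (key _ (s n).abs_one_sub_x_le) (key _ (s n).abs_one_sub_y_le)
      (key _ (s n).abs_one_sub_z_le) k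
    refine ⟨ρ, ?_, bounds_of_mul_exp h2 h3⟩
    simp only [hk]
    linarith

theorem Shape.Spherical.hsq_pos {s : Shape} (hs : s.Spherical) : 0 < s.hsq :=
  div_pos hs.gram_pos (by nlinarith [hs.x_gt, hs.x_lt])

theorem IsNestedShape.spherical_bounds {s : ℕ → Shape} (hn : IsNestedShape s)
    (hs : ∀ n, (s n).Spherical) (h1 : (s 0).defect ≤ 1) (n : ℕ) :
    (s n).defect ≤ (s 0).defect ∧
    Real.exp (-(4 * (s 0).defect)) * (s 0).hsq ≤ 4 ^ n * (s n).hsq ∧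
    4 ^ n * (s n).hsq ≤ Real.exp (4 * (s 0).defect) * (s 0).hsq := by
  have hstep : ∀ n, (s n).defect ≤ 1 → (s (n + 1)).defect ≤ (s n).defect / 2 := fun n h => by
    obtain ⟨k, hk⟩ := hn n
    have := hs (n + 1)
    rw [hk] at this ⊢
    exact (hs n).defect_child_le h this
  have hd1 : ∀ n, (s n).defect ≤ 1 := fun n => by
    induction n with
    | zero => exact h1
    | succ n ih => linarith [hstep n ih]
  have hd := fun n => hstep n (hd1 n)
  refine ⟨antitone_of_le_half (fun n => (s n).defect_nonneg) hd (Nat.zero_le n), ?_⟩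
  refine pow_mul_mem_exp_bounds n (fun n => (s n).hsq) (fun n => (s n).defect)
    (fun n => (hs n).hsq_pos.le) ?_ (fun n => (s n).defect_nonneg) hd
  intro n
  obtain ⟨k, hk⟩ := hn n
  have key : ∀ x : ℝ, |1 - x| ≤ (s n).defect → Real.exp (-(s n).defect) ≤ (1 + x) / 2 := by
    intro x hx
    have := exp_neg_le_one_sub_half (s n).defect_nonneg (hd1 n)
    rw [abs_le] at hx
    linarith
  obtain ⟨ρ, h1, h2, h3⟩ := (hs n).exists_ratio (Real.exp_pos (-(s n).defect))
    (key _ (s n).abs_one_sub_x_le) (key _ (s n).abs_one_sub_y_le)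
    (key _ (s n).abs_one_sub_z_le) k
  exact ⟨ρ, by simpa only [hk] using h1, bounds_of_mul_exp h2 h3⟩

/-! ### Central projection: contraction of large spherical triangles -/

/-- The squared distance of the central projections of two points to the affine plane on which a
linear functional is `1`, where `x` is the form of the two points and `f`, `g` are the values of
the functional on them. -/
def chartDist (x f g : ℝ) : ℝ := 1 / f ^ 2 + 1 / g ^ 2 - 2 * x / (f * g)

theorem chartDist_comm (x f g : ℝ) : chartDist x f g = chartDist x g f := by
  simp only [chartDist, mul_comm f g]; ring

/-- Projecting to a plane outside the open unit ball does not shorten chords, so a small projected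
triangle has small defect. -/
theorem two_sub_le_chartDist {x f g : ℝ} (hx : x ≤ 1) (hf : 0 < f) (hf1 : f ≤ 1) (hg : 0 < g)
    (hg1 : g ≤ 1) : 2 - 2 * x ≤ chartDist x f g := by
  have h : chartDist x f g = (1 / f - 1 / g) ^ 2 + (2 - 2 * x) / (f * g) := by
    rw [chartDist]; field_simp; ring
  have h2 : 2 - 2 * x ≤ (2 - 2 * x) / (f * g) :=
    le_div_self (by linarith) (by positivity) (mul_le_one₀ hf1 hg.le hg1)
  rw [h]
  linarith [sq_nonneg (1 / f - 1 / g)]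

/-- The midpoint projects to the point dividing the projected segment in the ratio g : f, at the
fraction g/(f + g) from the first endpoint. -/
theorem chartDist_half {x f g : ℝ} (hx : -1 < x) (hf : 0 < f) (hg : 0 < g) :
    chartDist (halfCos x) f ((f + g) / (2 * halfCos x)) = (g / (f + g)) ^ 2 * chartDist x f g := by
  have h1 := halfCos_pos hx
  have h2 := halfCos_sq hx
  have h3 : f + g ≠ 0 := by positivity
  have e : chartDist (halfCos x) f ((f + g) / (2 * halfCos x)) =
      1 / f ^ 2 + 4 * halfCos x ^ 2 / (f + g) ^ 2 - 4 * halfCos x ^ 2 / (f * (f + g)) := by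
    rw [chartDist]; field_simp; ring
  rw [e, h2, chartDist]
  field_simp
  ring

/-- With projected edge vectors u, v at the common vertex and fractions s, t along them, this is |s
u - t v|² with 2 u·v = |u|² + |v|² - |u - v|². -/
theorem chartDist_mid {x y z f g h : ℝ} (hy : -1 < y) (hz : -1 < z) (hf : 0 < f) (hg : 0 < g)
    (hh : 0 < h) :
    chartDist (midForm x y z) ((h + f) / (2 * halfCos y)) ((f + g) / (2 * halfCos z)) =
      h / (h + f) * (h / (h + f) - g / (f + g)) * chartDist y h f +
      g / (f + g) * (g / (f + g) - h / (h + f)) * chartDist z f g +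
      h / (h + f) * (g / (f + g)) * chartDist x g h := by
  have h1 := halfCos_pos hy
  have h2 := halfCos_sq hy
  have h1' := halfCos_pos hz
  have h2' := halfCos_sq hz
  have h3 : f + g ≠ 0 := by positivity
  have h4 : h + f ≠ 0 := by positivity
  have e : chartDist (midForm x y z) ((h + f) / (2 * halfCos y)) ((f + g) / (2 * halfCos z)) =
      4 * halfCos y ^ 2 / (h + f) ^ 2 + 4 * halfCos z ^ 2 / (f + g) ^ 2 -
        2 * (1 + x + y + z) / ((h + f) * (f + g)) := by
    rw [chartDist, midForm]; field_simp; ring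
  rw [e, h2, h2']
  simp only [chartDist]
  field_simp
  ring

theorem chartDist_half_le {x f g τ X : ℝ} (hx : -1 < x) (hf : 0 < f) (hg : 0 < g)
    (hτ : g / (f + g) ≤ τ) (hX : chartDist x f g ≤ X) (hX0 : 0 ≤ X) :
    chartDist (halfCos x) f ((f + g) / (2 * halfCos x)) ≤ τ ^ 2 * X := by
  rw [chartDist_half hx hf hg]
  have h0 : 0 ≤ g / (f + g) := by positivity
  exact (mul_le_mul_of_nonneg_left hX (by positivity)).trans
    (mul_le_mul_of_nonneg_right (pow_le_pow_left₀ h0 hτ 2) hX0)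

theorem chartDist_mid_le {x y z f g h τ X : ℝ} (hy : -1 < y) (hz : -1 < z) (hf : 0 < f)
    (hg : 0 < g) (hh : 0 < h) (h1 : h / (h + f) ≤ τ) (h2 : g / (f + g) ≤ τ)
    (hy0 : 0 ≤ chartDist y h f) (hz0 : 0 ≤ chartDist z f g)
    (hxX : chartDist x g h ≤ X) (hyX : chartDist y h f ≤ X) (hzX : chartDist z f g ≤ X) :
    chartDist (midForm x y z) ((h + f) / (2 * halfCos y)) ((f + g) / (2 * halfCos z)) ≤
      τ ^ 2 * X := by
  rw [chartDist_mid hy hz hf hg hh]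
  have hs : 0 ≤ h / (h + f) := by positivity
  have ht : 0 ≤ g / (f + g) := by positivity
  generalize h / (h + f) = s at *
  generalize g / (f + g) = t at *
  have hX0 : 0 ≤ X := hy0.trans hyX
  have h3 := mul_le_mul_of_nonneg_left hxX (mul_nonneg hs ht)
  -- The term with a nonpositive coefficient is dropped; the other two coefficients add up to max(s,
  -- t)².
  rcases le_total s t with h | h
  · have a1 := mul_nonneg (mul_nonneg hs (sub_nonneg.2 h)) hy0
    have a2 := mul_le_mul_of_nonneg_left hzX (mul_nonneg ht (sub_nonneg.2 h))
    have a3 := mul_le_mul_of_nonneg_right (pow_le_pow_left₀ ht h2 2) hX0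
    nlinarith
  · have a1 := mul_nonneg (mul_nonneg ht (sub_nonneg.2 h)) hz0
    have a2 := mul_le_mul_of_nonneg_left hyX (mul_nonneg hs (sub_nonneg.2 h))
    have a3 := mul_le_mul_of_nonneg_right (pow_le_pow_left₀ hs h1 2) hX0
    nlinarith

/-- The values of a linear functional on the three vertices of a triangle. -/
structure Weights where
  f : ℝ
  g : ℝ
  h : ℝ

/-- The values of a linear functional on the vertices of a triangle of the medial subdivision. -/
def Weights.child (w : Weights) (s : Shape) : Piece → Weights
  | .inner => ⟨(w.g + w.h) / (2 * halfCos s.x), (w.h + w.f) / (2 * halfCos s.y),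
      (w.f + w.g) / (2 * halfCos s.z)⟩
  | .outerA => ⟨w.f, (w.f + w.g) / (2 * halfCos s.z), (w.h + w.f) / (2 * halfCos s.y)⟩
  | .outerB => ⟨(w.f + w.g) / (2 * halfCos s.z), w.g, (w.g + w.h) / (2 * halfCos s.x)⟩
  | .outerC => ⟨(w.h + w.f) / (2 * halfCos s.y), (w.g + w.h) / (2 * halfCos s.x), w.h⟩

/-- All three values lie in the interval `[m, 1]`. -/
structure Weights.Within (m : ℝ) (w : Weights) : Prop where
  le_f : m ≤ w.f
  f_le : w.f ≤ 1
  le_g : m ≤ w.g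
  g_le : w.g ≤ 1
  le_h : m ≤ w.h
  h_le : w.h ≤ 1

/-- The squared diameter of the projected triangle. -/
def chartSize (s : Shape) (w : Weights) : ℝ :=
  max (chartDist s.x w.g w.h) (max (chartDist s.y w.h w.f) (chartDist s.z w.f w.g))

theorem chartSize_child_le {s : Shape} (hs : s.Spherical) {w : Weights} {m : ℝ} (hm : 0 < m)
    (hw : w.Within m) (k : Piece) :
    chartSize (s.child k) (w.child s k) ≤ (1 / (1 + m)) ^ 2 * chartSize s w := by
  obtain ⟨hG, hx1, hx2, hy1, hy2, hz1, hz2⟩ := hs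
  obtain ⟨f1, f2, g1, g2, h1, h2⟩ := hw
  have f0 : 0 < w.f := hm.trans_le f1
  have g0 : 0 < w.g := hm.trans_le g1
  have h0 : 0 < w.h := hm.trans_le h1
  have hX : chartDist s.x w.g w.h ≤ chartSize s w := le_max_left _ _
  have hY : chartDist s.y w.h w.f ≤ chartSize s w := (le_max_left _ _).trans (le_max_right _ _)
  have hZ : chartDist s.z w.f w.g ≤ chartSize s w := (le_max_right _ _).trans (le_max_right _ _)
  have hX0 : 0 ≤ chartDist s.x w.g w.h := by
    linarith [two_sub_le_chartDist hx2.le g0 g2 h0 h2]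
  have hY0 : 0 ≤ chartDist s.y w.h w.f := by
    linarith [two_sub_le_chartDist hy2.le h0 h2 f0 f2]
  have hZ0 : 0 ≤ chartDist s.z w.f w.g := by
    linarith [two_sub_le_chartDist hz2.le f0 f2 g0 g2]
  have hS0 : 0 ≤ chartSize s w := hX0.trans hX
  have key : ∀ a b : ℝ, m ≤ a → a ≤ 1 → m ≤ b → b ≤ 1 → b / (a + b) ≤ 1 / (1 + m) := by
    intro a b ha ha1 hb hb1
    rw [div_le_div_iff₀ (by linarith) (by linarith)]
    nlinarith
  have key' : ∀ a b : ℝ, m ≤ a → a ≤ 1 → m ≤ b → b ≤ 1 → b / (b + a) ≤ 1 / (1 + m) := by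
    intro a b ha ha1 hb hb1
    rw [add_comm]; exact key a b ha ha1 hb hb1
  have mx := chartDist_mid_le hy1 hz1 f0 g0 h0 (key' _ _ f1 f2 h1 h2) (key _ _ f1 f2 g1 g2)
    hY0 hZ0 hX hY hZ
  have my := chartDist_mid_le hz1 hx1 g0 h0 f0 (key' _ _ g1 g2 f1 f2) (key _ _ g1 g2 h1 h2)
    hZ0 hX0 hY hZ hX
  have mz := chartDist_mid_le hx1 hy1 h0 f0 g0 (key' _ _ h1 h2 g1 g2) (key _ _ h1 h2 f1 f2)
    hX0 hY0 hZ hX hY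
  have xg := chartDist_half_le hx1 g0 h0 (key _ _ g1 g2 h1 h2) hX hS0
  have yh := chartDist_half_le hy1 h0 f0 (key _ _ h1 h2 f1 f2) hY hS0
  have zf := chartDist_half_le hz1 f0 g0 (key _ _ f1 f2 g1 g2) hZ hS0
  rw [chartDist_comm] at hX hY hZ
  have xh := chartDist_half_le hx1 h0 g0 (key _ _ h1 h2 g1 g2) hX hS0
  have yf := chartDist_half_le hy1 f0 h0 (key _ _ f1 f2 h1 h2) hY hS0
  have zg := chartDist_half_le hz1 g0 f0 (key _ _ g1 g2 f1 f2) hZ hS0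
  rw [add_comm w.h w.g, chartDist_comm] at xh
  rw [add_comm w.f w.h, chartDist_comm] at yf
  rw [add_comm w.g w.f, chartDist_comm] at zg
  refine max_le ?_ (max_le ?_ ?_) <;> cases k <;> simp only [Shape.child, Weights.child] <;>
    first | assumption | (rw [chartDist_comm]; assumption)

theorem Weights.Within.le_child {s : Shape} (hs : s.Spherical) {w : Weights} {m : ℝ} (hm : 0 < m)
    (hw : w.Within m) (k : Piece) :
    m ≤ (w.child s k).f ∧ m ≤ (w.child s k).g ∧ m ≤ (w.child s k).h := by
  obtain ⟨hG, hx1, hx2, hy1, hy2, hz1, hz2⟩ := hs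
  obtain ⟨f1, f2, g1, g2, h1, h2⟩ := hw
  have key : ∀ x a b : ℝ, -1 < x → x < 1 → m ≤ a → m ≤ b → m ≤ (a + b) / (2 * halfCos x) := by
    intro x a b hx hx' ha hb
    have := halfCos_pos hx
    have h1 : halfCos x ≤ 1 := Real.sqrt_le_one.2 (by linarith)
    rw [le_div_iff₀ (by positivity)]
    nlinarith
  have kx := key _ _ _ hx1 hx2 g1 h1
  have ky := key _ _ _ hy1 hy2 h1 f1
  have kz := key _ _ _ hz1 hz2 f1 g1
  cases k <;> simp only [Weights.child] <;> exact ⟨by assumption, by assumption, by assumption⟩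

/-- A nested sequence of spherical shapes together with the values of a linear functional of
norm `1` on the vertices, which are at least `m` for the initial triangle. -/
structure IsWeightedNested (m : ℝ) (s : ℕ → Shape) (w : ℕ → Weights) : Prop where
  step : ∀ n, ∃ k, s (n + 1) = (s n).child k ∧ w (n + 1) = (w n).child (s n) k
  spherical : ∀ n, (s n).Spherical
  f_le : ∀ n, (w n).f ≤ 1
  g_le : ∀ n, (w n).g ≤ 1
  h_le : ∀ n, (w n).h ≤ 1
  gh_le : ∀ n, (w n).g + (w n).h ≤ 2 * halfCos (s n).x
  hf_le : ∀ n, (w n).h + (w n).f ≤ 2 * halfCos (s n).y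
  fg_le : ∀ n, (w n).f + (w n).g ≤ 2 * halfCos (s n).z
  within : (w 0).Within m

namespace IsWeightedNested

variable {m : ℝ} {s : ℕ → Shape} {w : ℕ → Weights}

theorem isNestedShape (H : IsWeightedNested m s w) : IsNestedShape s := fun n =>
  let ⟨k, hk⟩ := H.step n
  ⟨k, hk.1⟩

theorem within_all (H : IsWeightedNested m s w) (hm : 0 < m) (n : ℕ) : (w n).Within m := by
  induction n with
  | zero => exact H.within
  | succ n ih =>
    obtain ⟨k, -, hk⟩ := H.step n
    obtain ⟨h1, h2, h3⟩ := ih.le_child (H.spherical n) hm k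
    rw [← hk] at h1 h2 h3
    exact ⟨h1, H.f_le _, h2, H.g_le _, h3, H.h_le _⟩

theorem chartSize_le (H : IsWeightedNested m s w) (hm : 0 < m) (n : ℕ) :
    chartSize (s n) (w n) ≤ ((1 / (1 + m)) ^ 2) ^ n * chartSize (s 0) (w 0) := by
  induction n with
  | zero => simp
  | succ n ih =>
    obtain ⟨k, h1, h2⟩ := H.step n
    rw [h1, h2, pow_succ', mul_assoc]
    exact (chartSize_child_le (H.spherical n) hm (H.within_all hm n) k).trans
      (mul_le_mul_of_nonneg_left ih (by positivity))

theorem defect_le (H : IsWeightedNested m s w) (hm : 0 < m) {n : ℕ}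
    (h : chartSize (s n) (w n) ≤ 2) : (s n).defect ≤ 1 := by
  obtain ⟨hG, hx1, hx2, hy1, hy2, hz1, hz2⟩ := H.spherical n
  obtain ⟨f1, f2, g1, g2, h1, h2⟩ := H.within_all hm n
  have hX : chartDist (s n).x (w n).g (w n).h ≤ 2 := (le_max_left _ _).trans h
  have hY : chartDist (s n).y (w n).h (w n).f ≤ 2 :=
    ((le_max_left _ _).trans (le_max_right _ _)).trans h
  have hZ : chartDist (s n).z (w n).f (w n).g ≤ 2 :=
    ((le_max_right _ _).trans (le_max_right _ _)).trans h
  have hX0 := two_sub_le_chartDist hx2.le (by linarith) g2 (by linarith) h2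
  have hY0 := two_sub_le_chartDist hy2.le (by linarith) h2 (by linarith) f2
  have hZ0 := two_sub_le_chartDist hz2.le (by linarith) f2 (by linarith) g2
  refine max_le ?_ (max_le ?_ ?_) <;> rw [abs_le] <;> constructor <;> linarith

/-- The half-angle cosine of a side is at least the mean of the functional at its ends, hence at
least m. So μ = m² is admissible in `exists_ratio`, which loses a factor m⁴. -/
theorem coarse_step (H : IsWeightedNested m s w) (hm : 0 < m) (n : ℕ) :
    m ^ 4 * (s n).hsq ≤ 4 * (s (n + 1)).hsq ∧ m ^ 4 * (4 * (s (n + 1)).hsq) ≤ (s n).hsq := by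
  obtain ⟨k, hk, -⟩ := H.step n
  have hs := H.spherical n
  have hw := H.within_all hm n
  have key : ∀ x a b : ℝ, -1 < x → a + b ≤ 2 * halfCos x → m ≤ a → m ≤ b →
      m ^ 2 ≤ (1 + x) / 2 := by
    intro x a b hx h ha hb
    rw [← halfCos_sq hx]
    exact pow_le_pow_left₀ hm.le (by linarith) 2
  obtain ⟨ρ, h1, h2, h3⟩ := hs.exists_ratio (pow_pos hm 2)
    (key _ _ _ hs.x_gt (H.gh_le n) hw.le_g hw.le_h) (key _ _ _ hs.y_gt (H.hf_le n) hw.le_h hw.le_f)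
    (key _ _ _ hs.z_gt (H.fg_le n) hw.le_f hw.le_g) k
  rw [← pow_mul] at h2 h3
  rw [hk, h1]
  have := hs.hsq_pos
  constructor
  · exact mul_le_mul_of_nonneg_right h2 this.le
  · rw [← mul_assoc, mul_comm _ ρ]
    exact mul_le_of_le_one_left this.le h3

theorem coarse_pow (H : IsWeightedNested m s w) (hm : 0 < m) (n : ℕ) :
    (m ^ 4) ^ n * (s 0).hsq ≤ 4 ^ n * (s n).hsq ∧
      (m ^ 4) ^ n * (4 ^ n * (s n).hsq) ≤ (s 0).hsq := by
  induction n with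
  | zero => simp
  | succ n ih =>
    obtain ⟨h1, h2⟩ := H.coarse_step hm n
    have hm4 : 0 < m ^ 4 := by positivity
    constructor
    · calc (m ^ 4) ^ (n + 1) * (s 0).hsq = m ^ 4 * ((m ^ 4) ^ n * (s 0).hsq) := by ring
        _ ≤ m ^ 4 * (4 ^ n * (s n).hsq) := mul_le_mul_of_nonneg_left ih.1 hm4.le
        _ = 4 ^ n * (m ^ 4 * (s n).hsq) := by ring
        _ ≤ 4 ^ n * (4 * (s (n + 1)).hsq) := mul_le_mul_of_nonneg_left h1 (by positivity)
        _ = _ := by ring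
    · calc (m ^ 4) ^ (n + 1) * (4 ^ (n + 1) * (s (n + 1)).hsq)
          = (m ^ 4) ^ n * (4 ^ n * (m ^ 4 * (4 * (s (n + 1)).hsq))) := by ring
        _ ≤ (m ^ 4) ^ n * (4 ^ n * (s n).hsq) := by gcongr
        _ ≤ _ := ih.2

/-- The heights in nested sequences of spherical triangles are comparable to `2⁻ⁿ`, uniformly
over all sequences with controlled initial triangle. -/
theorem exists_bounds (hm : 0 < m) (hm1 : m ≤ 1) (X : ℝ) :
    ∃ c, 0 < c ∧ ∀ (s : ℕ → Shape) (w : ℕ → Weights), IsWeightedNested m s w →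
      chartSize (s 0) (w 0) ≤ X → ∀ n, c * (s 0).hsq ≤ 4 ^ n * (s n).hsq ∧
        c * (4 ^ n * (s n).hsq) ≤ (s 0).hsq := by
  have hτ : (1 / (1 + m)) ^ 2 < 1 :=
    pow_lt_one₀ (by positivity) ((div_lt_one (by linarith)).2 (by linarith)) two_ne_zero
  -- N depends only on m and X, which makes the bound uniform over all sequences.
  obtain ⟨N, hN⟩ := exists_pow_lt_of_lt_one (show 0 < 2 / (|X| + 1) by positivity) hτ
  have hm4 : 0 < m ^ 4 := by positivity
  have hm41 : m ^ 4 ≤ 1 := pow_le_one₀ hm.le hm1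
  -- The power pays for the first N steps, exp(-4) for all later ones, which start from a triangle
  -- of defect at most 1.
  refine ⟨(m ^ 4) ^ N * Real.exp (-4), by positivity, fun s w H hX n => ?_⟩
  have hsize : chartSize (s N) (w N) ≤ 2 := by
    refine (H.chartSize_le hm N).trans ?_
    rw [lt_div_iff₀ (by positivity)] at hN
    refine le_trans ?_ hN.le
    exact mul_le_mul_of_nonneg_left (by linarith [le_abs_self X]) (by positivity)
  have hpos := fun n => (H.spherical n).hsq_pos
  have hexp : Real.exp (-4) ≤ 1 := Real.exp_le_one_iff.2 (by norm_num)
  rcases le_total n N with hn | hn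
  · obtain ⟨h1, h2⟩ := H.coarse_pow hm n
    have h3 : (m ^ 4) ^ N * Real.exp (-4) ≤ (m ^ 4) ^ n :=
      (mul_le_of_le_one_right (by positivity) hexp).trans (pow_le_pow_of_le_one hm4.le hm41 hn)
    have h4 : 0 < 4 ^ n * (s n).hsq := mul_pos (by positivity) (hpos n)
    exact ⟨(mul_le_mul_of_nonneg_right h3 (hpos 0).le).trans h1,
      (mul_le_mul_of_nonneg_right h3 h4.le).trans h2⟩
  · obtain ⟨j, rfl⟩ := Nat.exists_eq_add_of_le hn
    obtain ⟨h1, h2⟩ := H.coarse_pow hm N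
    have hd := H.defect_le hm hsize
    obtain ⟨-, h3, h4⟩ := IsNestedShape.spherical_bounds (s := fun n => s (N + n))
      (fun n => H.isNestedShape (N + n)) (fun n => H.spherical (N + n)) hd j
    simp only [add_zero] at h3 h4
    have h5 : Real.exp (-4) * (s N).hsq ≤ 4 ^ j * (s (N + j)).hsq :=
      (mul_le_mul_of_nonneg_right (Real.exp_le_exp.2 (by linarith)) (hpos N).le).trans h3
    have h6 : Real.exp (-4) * (4 ^ j * (s (N + j)).hsq) ≤ (s N).hsq := by
      rw [Real.exp_neg, inv_mul_le_iff₀ (Real.exp_pos _)]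
      exact h4.trans
        (mul_le_mul_of_nonneg_right (Real.exp_le_exp.2 (by linarith)) (hpos N).le)
    constructor
    · calc (m ^ 4) ^ N * Real.exp (-4) * (s 0).hsq
          = Real.exp (-4) * ((m ^ 4) ^ N * (s 0).hsq) := by ring
        _ ≤ Real.exp (-4) * (4 ^ N * (s N).hsq) := by gcongr
        _ = 4 ^ N * (Real.exp (-4) * (s N).hsq) := by ring
        _ ≤ 4 ^ N * (4 ^ j * (s (N + j)).hsq) := by gcongr
        _ = _ := by ring
    · calc (m ^ 4) ^ N * Real.exp (-4) * (4 ^ (N + j) * (s (N + j)).hsq)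
          = (m ^ 4) ^ N * (4 ^ N * (Real.exp (-4) * (4 ^ j * (s (N + j)).hsq))) := by ring
        _ ≤ (m ^ 4) ^ N * (4 ^ N * (s N).hsq) := by gcongr
        _ ≤ _ := h2

end IsWeightedNested

/-! ### From triangles in the model plane to shapes -/

variable {κ : ℝ}

theorem form_comm (u v : Fin 3 → ℝ) : form κ u v = form κ v u := by
  simp only [form]; ring

theorem ModelPlane.form_self (p : ModelPlane κ) : form κ p.vec p.vec = 1 := p.2.1

theorem form_self_nonneg (hκ : 0 < κ) (u : Fin 3 → ℝ) : 0 ≤ form κ u u := by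
  simp only [form]
  nlinarith [mul_self_nonneg (u 0), mul_nonneg hκ.le (mul_self_nonneg (u 1)),
    mul_nonneg hκ.le (mul_self_nonneg (u 2))]

theorem form_le_one (hκ : 0 < κ) (p q : ModelPlane κ) : form κ p.vec q.vec ≤ 1 := by
  have h := form_self_nonneg hκ (p.vec - q.vec)
  have e : form κ (p.vec - q.vec) (p.vec - q.vec) =
      form κ p.vec p.vec + form κ q.vec q.vec - 2 * form κ p.vec q.vec := by
    simp only [form, Pi.sub_apply]; ring
  rw [e, p.form_self, q.form_self] at h
  linarith

theorem neg_one_le_form (hκ : 0 < κ) (p q : ModelPlane κ) : -1 ≤ form κ p.vec q.vec := by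
  have h := form_self_nonneg hκ (p.vec + q.vec)
  have e : form κ (p.vec + q.vec) (p.vec + q.vec) =
      form κ p.vec p.vec + form κ q.vec q.vec + 2 * form κ p.vec q.vec := by
    simp only [form, Pi.add_apply]; ring
  rw [e, p.form_self, q.form_self] at h
  linarith

theorem one_le_form (hκ : κ < 0) (p q : ModelPlane κ) : 1 ≤ form κ p.vec q.vec := by
  have hp := p.form_self
  have hq := q.form_self
  have hp0 : 0 < p.vec 0 := p.2.2 hκ.le
  have hq0 : 0 < q.vec 0 := q.2.2 hκ.le
  simp only [form] at hp hq ⊢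
  generalize p.vec 0 = a0 at *
  generalize p.vec 1 = a1 at *
  generalize p.vec 2 = a2 at *
  generalize q.vec 0 = b0 at *
  generalize q.vec 1 = b1 at *
  generalize q.vec 2 = b2 at *
  -- Lagrange's identity, which gives the reversed Cauchy–Schwarz inequality on the hyperboloid.
  have e : (a0 * b0) ^ 2 = (1 - κ * (a1 * b1 + a2 * b2)) ^ 2
      + (-κ) * ((a1 - b1) ^ 2 + (a2 - b2) ^ 2)
      + κ ^ 2 * (a1 * b2 - a2 * b1) ^ 2 := by
    have h1 : a0 * a0 = 1 - κ * (a1 * a1 + a2 * a2) := by linarith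
    have h2 : b0 * b0 = 1 - κ * (b1 * b1 + b2 * b2) := by linarith
    have : (a0 * b0) ^ 2 = (a0 * a0) * (b0 * b0) := by ring
    rw [this, h1, h2]; ring
  have h : (1 - κ * (a1 * b1 + a2 * b2)) ^ 2 ≤ (a0 * b0) ^ 2 := by
    have := mul_nonneg (neg_nonneg.2 hκ.le) (add_nonneg (sq_nonneg (a1 - b1)) (sq_nonneg (a2 - b2)))
    have := mul_nonneg (sq_nonneg κ) (sq_nonneg (a1 * b2 - a2 * b1))
    linarith
  have := le_of_abs_le (abs_le_of_sq_le_sq h (by positivity))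
  linarith

/-- The determinant of the vertices of a triangle. -/
def Triangle.det (T : Triangle κ) : ℝ := Matrix.det (Matrix.of ![T.A.vec, T.B.vec, T.C.vec])

theorem Triangle.det_ne_zero (T : Triangle κ) : T.det ≠ 0 := by
  have h : LinearIndependent ℝ (Matrix.of ![T.A.vec, T.B.vec, T.C.vec]).row := T.nondegenerate
  rw [Matrix.linearIndependent_rows_iff_isUnit, Matrix.isUnit_iff_isUnit_det] at h
  exact h.ne_zero

theorem Triangle.det_eq (T : Triangle κ) : T.det =
    T.A.vec 0 * T.B.vec 1 * T.C.vec 2 - T.A.vec 0 * T.B.vec 2 * T.C.vec 1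
    - T.A.vec 1 * T.B.vec 0 * T.C.vec 2 + T.A.vec 1 * T.B.vec 2 * T.C.vec 0
    + T.A.vec 2 * T.B.vec 0 * T.C.vec 1 - T.A.vec 2 * T.B.vec 1 * T.C.vec 0 := by
  rw [Triangle.det, Matrix.det_fin_three]; rfl

/-- The shape of a triangle. -/
def Triangle.shape (T : Triangle κ) : Shape :=
  ⟨form κ T.B.vec T.C.vec, form κ T.C.vec T.A.vec, form κ T.A.vec T.B.vec⟩

/-- The form has determinant κ², so Gram matrices of three vectors have determinant κ² times their
squared volume. -/
theorem Triangle.gram_shape (T : Triangle κ) : T.shape.gram = κ ^ 2 * T.det ^ 2 := by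
  have e : ∀ u v w : Fin 3 → ℝ, form κ u u * form κ v v * form κ w w
      + 2 * form κ v w * form κ w u * form κ u v - form κ u u * form κ v w ^ 2
      - form κ v v * form κ w u ^ 2 - form κ w w * form κ u v ^ 2 =
      κ ^ 2 * (u 0 * v 1 * w 2 - u 0 * v 2 * w 1 - u 1 * v 0 * w 2 + u 1 * v 2 * w 0
        + u 2 * v 0 * w 1 - u 2 * v 1 * w 0) ^ 2 := by
    intro u v w; simp only [form]; ring
  have h := e T.A.vec T.B.vec T.C.vec
  rw [T.A.form_self, T.B.form_self, T.C.form_self, ← T.det_eq] at h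
  rw [← h, Shape.gram, Triangle.shape]
  ring

theorem Triangle.gram_shape_pos (hκ : κ ≠ 0) (T : Triangle κ) : 0 < T.shape.gram := by
  rw [T.gram_shape]
  have := T.det_ne_zero
  positivity

theorem Shape.gram_eq_xy (s : Shape) :
    s.gram = (1 - s.x ^ 2) * (1 - s.y ^ 2) - (s.z - s.x * s.y) ^ 2 := by
  simp only [gram]; ring

theorem Shape.gram_eq_xz (s : Shape) :
    s.gram = (1 - s.x ^ 2) * (1 - s.z ^ 2) - (s.y - s.x * s.z) ^ 2 := by
  simp only [gram]; ring

theorem Triangle.spherical_shape (hκ : 0 < κ) (T : Triangle κ) : T.shape.Spherical := by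
  have hG := T.gram_shape_pos hκ.ne'
  have h1 := T.shape.gram_eq_xy
  have h2 := T.shape.gram_eq_xz
  have hxy : 0 < (1 - T.shape.x ^ 2) * (1 - T.shape.y ^ 2) := by
    linarith [sq_nonneg (T.shape.z - T.shape.x * T.shape.y)]
  have hxz : 0 < (1 - T.shape.x ^ 2) * (1 - T.shape.z ^ 2) := by
    linarith [sq_nonneg (T.shape.y - T.shape.x * T.shape.z)]
  have key : ∀ p q : ModelPlane κ, 1 - form κ p.vec q.vec ^ 2 ≠ 0 →
      -1 < form κ p.vec q.vec ∧ form κ p.vec q.vec < 1 := by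
    intro p q h
    have h1 := form_le_one hκ p q
    have h2 := neg_one_le_form hκ p q
    refine ⟨lt_of_le_of_ne h2 fun e => h ?_, lt_of_le_of_ne h1 fun e => h ?_⟩
    · rw [← e]; norm_num
    · rw [e]; norm_num
  obtain ⟨a1, a2⟩ := key T.B T.C (left_ne_zero_of_mul hxy.ne')
  obtain ⟨b1, b2⟩ := key T.C T.A (right_ne_zero_of_mul hxy.ne')
  obtain ⟨c1, c2⟩ := key T.A T.B (right_ne_zero_of_mul hxz.ne')
  exact ⟨hG, a1, a2, b1, b2, c1, c2⟩

theorem Triangle.hyperbolic_shape (hκ : κ < 0) (T : Triangle κ) : T.shape.Hyperbolic := by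
  have hG := T.gram_shape_pos hκ.ne
  have h1 := T.shape.gram_eq_xy
  have h2 := T.shape.gram_eq_xz
  have hxy : 0 < (1 - T.shape.x ^ 2) * (1 - T.shape.y ^ 2) := by
    linarith [sq_nonneg (T.shape.z - T.shape.x * T.shape.y)]
  have hxz : 0 < (1 - T.shape.x ^ 2) * (1 - T.shape.z ^ 2) := by
    linarith [sq_nonneg (T.shape.y - T.shape.x * T.shape.z)]
  have key : ∀ p q : ModelPlane κ, 1 - form κ p.vec q.vec ^ 2 ≠ 0 → 1 < form κ p.vec q.vec := by
    intro p q h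
    refine lt_of_le_of_ne (one_le_form hκ p q) fun e => h ?_
    rw [← e]; norm_num
  exact ⟨hG, key T.B T.C (left_ne_zero_of_mul hxy.ne'), key T.C T.A (right_ne_zero_of_mul hxy.ne'),
    key T.A T.B (right_ne_zero_of_mul hxz.ne')⟩

theorem Triangle.neg_one_lt_shape (hκ : κ ≠ 0) (T : Triangle κ) :
    -1 < T.shape.x ∧ -1 < T.shape.y ∧ -1 < T.shape.z := by
  rcases hκ.lt_or_gt with h | h
  · have := T.hyperbolic_shape h
    exact ⟨by linarith [this.x_gt], by linarith [this.y_gt], by linarith [this.z_gt]⟩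
  · have := T.spherical_shape h
    exact ⟨this.x_gt, this.y_gt, this.z_gt⟩

theorem cosh_half_eq (t : ℝ) : Real.cosh (t / 2) = √((1 + Real.cosh t) / 2) := by
  have h1 := Real.cosh_two_mul (t / 2)
  have h2 := Real.cosh_sq (t / 2)
  rw [mul_div_cancel₀ t two_ne_zero] at h1
  rw [eq_comm, Real.sqrt_eq_iff_mul_self_eq_of_pos (Real.cosh_pos _)]
  linarith

theorem form_eq_halfCos (hκ : κ ≠ 0) {p q m m' : ModelPlane κ}
    (h : gdist m m' = gdist p q / 2) :
    form κ m.vec m'.vec = halfCos (form κ p.vec q.vec) := by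
  rcases hκ.lt_or_gt with hκ | hκ
  · have hs : 0 < √(-κ) := Real.sqrt_pos.2 (by linarith)
    simp only [gdist, not_lt.2 hκ.le, hκ, if_true, if_false] at h
    have h' : Real.arcosh (form κ m.vec m'.vec) = Real.arcosh (form κ p.vec q.vec) / 2 := by
      field_simp at h ⊢; linarith
    rw [← Real.cosh_arcosh (one_le_form hκ m m'), h', cosh_half_eq,
      Real.cosh_arcosh (one_le_form hκ p q)]
    rfl
  · have hs : 0 < √κ := Real.sqrt_pos.2 hκ
    simp only [gdist, hκ, if_true] at h
    have h' : Real.arccos (form κ m.vec m'.vec) = Real.arccos (form κ p.vec q.vec) / 2 := by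
      field_simp at h ⊢; linarith
    rw [← Real.cos_arccos (neg_one_le_form hκ m m') (form_le_one hκ m m'), h', Real.cos_half,
      Real.cos_arccos (neg_one_le_form hκ p q) (form_le_one hκ p q)]
    · rfl
    · linarith [Real.arccos_nonneg (form κ p.vec q.vec), Real.pi_pos]
    · exact Real.arccos_le_pi _

/-- For κ < 0 the form is indefinite, but it is definite on the orthogonal complement of a point of
the hyperboloid. The argument covers both signs of κ. -/
theorem eq_zero_of_form_eq_zero (hκ : κ ≠ 0) (m : ModelPlane κ) {e : Fin 3 → ℝ}
    (h1 : form κ e e = 0) (h2 : form κ e m.vec = 0) : e = 0 := by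
  have hm := m.form_self
  simp only [form] at h1 h2 hm
  have h0 : e 0 = 0 := by
    have e1 : (e 0 * m.vec 0) ^ 2 = (e 0 * e 0) * (m.vec 0 * m.vec 0 - 1)
        - κ ^ 2 * (e 1 * m.vec 2 - e 2 * m.vec 1) ^ 2 := by
      have a1 : e 0 * m.vec 0 = -(κ * (e 1 * m.vec 1 + e 2 * m.vec 2)) := by linarith
      have a2 : e 0 * e 0 = -(κ * (e 1 * e 1 + e 2 * e 2)) := by linarith
      have a3 : m.vec 0 * m.vec 0 - 1 = -(κ * (m.vec 1 * m.vec 1 + m.vec 2 * m.vec 2)) := by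
        linarith
      rw [a1, a2, a3]; ring
    have : e 0 ^ 2 ≤ 0 := by
      nlinarith [mul_nonneg (sq_nonneg κ) (sq_nonneg (e 1 * m.vec 2 - e 2 * m.vec 1))]
    exact pow_eq_zero_iff two_ne_zero |>.1 (le_antisymm this (sq_nonneg _))
  rw [h0] at h1
  have h3 : e 1 * e 1 + e 2 * e 2 = 0 := by
    rcases mul_eq_zero.1 (show κ * (e 1 * e 1 + e 2 * e 2) = 0 by linarith) with h | h
    · exact absurd h hκ
    · exact h
  have h4 : e 1 = 0 := by
    have : e 1 * e 1 = 0 := by nlinarith [mul_self_nonneg (e 1), mul_self_nonneg (e 2)]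
    exact mul_self_eq_zero.1 this
  have h5 : e 2 = 0 := by
    have : e 2 * e 2 = 0 := by nlinarith [mul_self_nonneg (e 1), mul_self_nonneg (e 2)]
    exact mul_self_eq_zero.1 this
  funext i
  fin_cases i <;> assumption

/-- The midpoint is the normalized sum of the endpoints. -/
theorem IsMidpoint.form_eq (hκ : κ ≠ 0) {m p q : ModelPlane κ} (h : IsMidpoint m p q)
    (hx : -1 < form κ p.vec q.vec) (v : Fin 3 → ℝ) :
    form κ v m.vec = (form κ v p.vec + form κ v q.vec) / (2 * halfCos (form κ p.vec q.vec)) := by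
  have h1 := form_eq_halfCos hκ h.1
  have h2 := form_eq_halfCos hκ h.2
  have hc := halfCos_pos hx
  have hc2 := halfCos_sq hx
  set c := halfCos (form κ p.vec q.vec) with hcdef
  -- The difference between 2c·m and p + q is isotropic and orthogonal to m, hence zero.
  set e : Fin 3 → ℝ := fun i => 2 * c * m.vec i - (p.vec i + q.vec i) with he
  have key : ∀ v : Fin 3 → ℝ,
      form κ v e = 2 * c * form κ v m.vec - (form κ v p.vec + form κ v q.vec) := by
    intro v; simp only [form, he]; ring
  have e1 : form κ e m.vec = 0 := by
    rw [form_comm, key, m.form_self, form_comm m.vec p.vec, h1, h2]; ring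
  have e2 : form κ e e = 0 := by
    rw [key, e1, form_comm e, key, form_comm e, key, h1, form_comm q.vec m.vec, h2, p.form_self,
      q.form_self, form_comm q.vec p.vec]
    linear_combination (-4) * hc2
  have e3 := eq_zero_of_form_eq_zero hκ m e2 e1
  have e4 := key v
  rw [e3] at e4
  have e5 : form κ v 0 = 0 := by simp [form]
  rw [eq_div_iff (by positivity)]
  linarith

/-- The values of the functional `form κ u` on the vertices of a triangle. -/
def Triangle.weights (T : Triangle κ) (u : Fin 3 → ℝ) : Weights :=
  ⟨form κ u T.A.vec, form κ u T.B.vec, form κ u T.C.vec⟩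

theorem IsMedialPiece.shape_eq (hκ : κ ≠ 0) {k : Piece} {S T : Triangle κ}
    (h : IsMedialPiece k S T) : T.shape = S.shape.child k ∧
      ∀ u, T.weights u = (S.weights u).child S.shape k := by
  obtain ⟨D, E, F, hD, hE, hF, hk⟩ := h
  obtain ⟨hx, hy, hz⟩ := S.neg_one_lt_shape hκ
  have fD := hD.form_eq hκ hx
  have fE := hE.form_eq hκ hy
  have fF := hF.form_eq hκ hz
  have hBD := form_eq_halfCos hκ hD.1
  have hDC := form_eq_halfCos hκ hD.2
  have hCE := form_eq_halfCos hκ hE.1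
  have hEA := form_eq_halfCos hκ hE.2
  have hAF := form_eq_halfCos hκ hF.1
  have hFB := form_eq_halfCos hκ hF.2
  have hx0 := halfCos_pos hx
  have hy0 := halfCos_pos hy
  have hz0 := halfCos_pos hz
  simp only [Triangle.shape] at hx hy hz hx0 hy0 hz0
  have hEF : form κ E.vec F.vec = midForm S.shape.x S.shape.y S.shape.z := by
    rw [fF, form_comm E.vec, form_comm E.vec, fE, fE, S.A.form_self, form_comm S.B.vec S.A.vec,
      form_comm S.A.vec S.C.vec]
    simp only [midForm, Triangle.shape]
    field_simp
    ring
  have hFD : form κ F.vec D.vec = midForm S.shape.y S.shape.z S.shape.x := by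
    rw [fD, form_comm F.vec, form_comm F.vec, fF, fF, S.B.form_self, form_comm S.B.vec S.A.vec,
      form_comm S.C.vec S.B.vec]
    simp only [midForm, Triangle.shape]
    field_simp
    ring
  have hDE : form κ D.vec E.vec = midForm S.shape.z S.shape.x S.shape.y := by
    rw [fE, form_comm D.vec, form_comm D.vec, fD, fD, S.C.form_self, form_comm S.C.vec S.B.vec,
      form_comm S.A.vec S.C.vec]
    simp only [midForm, Triangle.shape]
    field_simp
    ring
  cases k with
  | inner =>
    obtain ⟨rfl, rfl, rfl⟩ := hk
    exact ⟨by rw [Triangle.shape, hEF, hFD, hDE, Shape.child],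
      fun u => by rw [Triangle.weights, fD, fE, fF]; rfl⟩
  | outerA =>
    obtain ⟨hA, rfl, rfl⟩ := hk
    exact ⟨by rw [Triangle.shape, form_comm T.B.vec, hEF, hA, hEA, hAF, Shape.child]; rfl,
      fun u => by rw [Triangle.weights, fE, fF, hA]; rfl⟩
  | outerB =>
    obtain ⟨rfl, hB, rfl⟩ := hk
    exact ⟨by rw [Triangle.shape, form_comm T.C.vec, hFD, hB, hBD, hFB, Shape.child]; rfl,
      fun u => by rw [Triangle.weights, fD, fF, hB]; rfl⟩
  | outerC =>
    obtain ⟨rfl, rfl, hC⟩ := hk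
    exact ⟨by rw [Triangle.shape, form_comm T.A.vec, hDE, hC, hDC, hCE, Shape.child]; rfl,
      fun u => by rw [Triangle.weights, fD, fE, hC]; rfl⟩

/-! ### Heights: the foot of the perpendicular and comparison with `hsq` -/

/-- The Pythagorean relation between a vertex, a point `u B + v C` of the opposite line, and the
foot of the height. -/
theorem Shape.sq_form_line (s : Shape) (hx : 1 - s.x ^ 2 ≠ 0) {u v : ℝ}
    (h : u ^ 2 + v ^ 2 + 2 * u * v * s.x = 1) :
    (u * s.z + v * s.y) ^ 2 =
      1 - s.hsq - ((s.z - s.x * s.y) * v - (s.y - s.x * s.z) * u) ^ 2 / (1 - s.x ^ 2) := by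
  rw [hsq, gram]
  field_simp
  linear_combination (s.y ^ 2 + s.z ^ 2 - 2 * s.x * s.y * s.z) * h

theorem form_comb_left (u v : ℝ) (a b c : Fin 3 → ℝ) :
    form κ (u • a + v • b) c = u * form κ a c + v * form κ b c := by
  simp only [form, Pi.add_apply, Pi.smul_apply, smul_eq_mul]; ring

theorem form_comb_right (u v : ℝ) (a b c : Fin 3 → ℝ) :
    form κ c (u • a + v • b) = u * form κ c a + v * form κ c b := by
  rw [form_comm, form_comb_left, form_comm a, form_comm b]

theorem form_comb_self (u v : ℝ) (p q : ModelPlane κ) :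
    form κ (u • p.vec + v • q.vec) (u • p.vec + v • q.vec) =
      u ^ 2 + v ^ 2 + 2 * u * v * form κ p.vec q.vec := by
  rw [form_comb_left, form_comb_right, form_comb_right, p.form_self, q.form_self,
    form_comm q.vec p.vec]
  ring

theorem Triangle.exists_of_mem_line (T : Triangle κ) {X : ModelPlane κ}
    (hX : X ∈ geodesicLine T.B T.C) :
    ∃ u v : ℝ, u ^ 2 + v ^ 2 + 2 * u * v * T.shape.x = 1 ∧
      form κ T.A.vec X.vec = u * T.shape.z + v * T.shape.y := by
  obtain ⟨u, v, h⟩ := Submodule.mem_span_pair.1 hX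
  refine ⟨u, v, ?_, ?_⟩
  · have := form_comb_self u v T.B T.C
    rw [h, X.form_self] at this
    exact this.symm
  · rw [← h, form_comb_right, form_comm T.A.vec T.C.vec]; rfl

/-- The coefficients of the (normalized) foot of the height. -/
theorem Shape.foot (s : Shape) (hx : 1 - s.x ^ 2 ≠ 0) (hρ : 0 < 1 - s.hsq) :
    ∃ u v : ℝ, u ^ 2 + v ^ 2 + 2 * u * v * s.x = 1 ∧ u * s.z + v * s.y = √(1 - s.hsq) ∧
      u + v * s.x = s.z / √(1 - s.hsq) := by
  have hr := Real.sqrt_pos.2 hρ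
  have hr2 := Real.sq_sqrt hρ.le
  set r := √(1 - s.hsq)
  have e : r ^ 2 * (1 - s.x ^ 2) = s.y ^ 2 + s.z ^ 2 - 2 * s.x * s.y * s.z := by
    rw [hr2, hsq, gram]; field_simp; ring
  refine ⟨(s.z - s.x * s.y) / (1 - s.x ^ 2) / r, (s.y - s.x * s.z) / (1 - s.x ^ 2) / r, ?_, ?_, ?_⟩
  · field_simp
    linear_combination (-(1 - s.x ^ 2)) * e
  · field_simp
    linear_combination -e
  · field_simp
    ring

theorem Shape.Spherical.one_sub_sq_pos {s : Shape} (hs : s.Spherical) : 0 < 1 - s.x ^ 2 := by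
  nlinarith [hs.x_gt, hs.x_lt]

/-- C itself lies on the line BC, so the height is at most CA. -/
theorem Shape.Spherical.sq_y_le {s : Shape} (hs : s.Spherical) : s.y ^ 2 ≤ 1 - s.hsq := by
  have h := s.sq_form_line hs.one_sub_sq_pos.ne' (u := 0) (v := 1) (by norm_num)
  have := div_nonneg (sq_nonneg ((s.z - s.x * s.y) * 1 - (s.y - s.x * s.z) * 0))
    hs.one_sub_sq_pos.le
  rw [zero_mul, zero_add, one_mul] at h
  linarith

theorem Shape.Spherical.hsq_le_one {s : Shape} (hs : s.Spherical) : s.hsq ≤ 1 := by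
  linarith [hs.sq_y_le, sq_nonneg s.y]

theorem Triangle.height_of_pos (hκ : 0 < κ) (T : Triangle κ) :
    T.height = Real.arccos √(1 - T.shape.hsq) / √κ := by
  have hs := T.spherical_shape hκ
  have hx := hs.one_sub_sq_pos
  have hle : ∀ X ∈ geodesicLine T.B T.C, form κ T.A.vec X.vec ≤ √(1 - T.shape.hsq) := by
    intro X hX
    obtain ⟨u, v, h1, h2⟩ := T.exists_of_mem_line hX
    have h3 := T.shape.sq_form_line hx.ne' h1
    rw [h2]
    refine Real.le_sqrt_of_sq_le ?_
    have := div_nonneg (sq_nonneg ((T.shape.z - T.shape.x * T.shape.y) * v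
      - (T.shape.y - T.shape.x * T.shape.z) * u)) hx.le
    linarith
  have hex : ∃ X ∈ geodesicLine T.B T.C, form κ T.A.vec X.vec = √(1 - T.shape.hsq) := by
    -- In the equality case A is a pole of the great circle, all points of which are equally far; B
    -- serves as foot.
    rcases (sub_nonneg.2 hs.hsq_le_one).eq_or_lt with h | h
    · refine ⟨T.B, Submodule.subset_span (by simp), ?_⟩
      have h3 := T.shape.sq_form_line hx.ne' (u := 1) (v := 0) (by norm_num)
      rw [← h] at h3 ⊢
      rw [Real.sqrt_zero]
      have := div_nonneg (sq_nonneg ((T.shape.z - T.shape.x * T.shape.y) * 0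
        - (T.shape.y - T.shape.x * T.shape.z) * 1)) hx.le
      have h4 : T.shape.z ^ 2 = 0 := by
        rw [one_mul, zero_mul, add_zero] at h3
        exact le_antisymm (by linarith) (sq_nonneg _)
      exact pow_eq_zero_iff two_ne_zero |>.1 h4
    · obtain ⟨u, v, h1, h2, -⟩ := T.shape.foot hx.ne' h
      refine ⟨⟨u • T.B.vec + v • T.C.vec, ?_, fun h => absurd hκ (not_lt.2 h)⟩, ?_, ?_⟩
      · rw [form_comb_self]; exact h1
      · exact Submodule.mem_span_pair.2 ⟨u, v, rfl⟩
      · change form κ T.A.vec (u • T.B.vec + v • T.C.vec) = _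
        rw [form_comb_right, form_comm T.A.vec T.C.vec]
        exact h2
  refine IsLeast.csInf_eq ⟨?_, ?_⟩
  · obtain ⟨X, hX, h⟩ := hex
    exact ⟨X, hX, by simp only [gdist, hκ, if_true, h]⟩
  · rintro _ ⟨X, hX, rfl⟩
    simp only [gdist, hκ, if_true]
    exact div_le_div_of_nonneg_right (Real.antitone_arccos (hle X hX)) (Real.sqrt_nonneg _)

theorem Shape.Hyperbolic.one_sub_sq_neg {s : Shape} (hs : s.Hyperbolic) : 1 - s.x ^ 2 < 0 := by
  nlinarith [hs.x_gt]

theorem Shape.Hyperbolic.hsq_neg {s : Shape} (hs : s.Hyperbolic) : s.hsq < 0 :=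
  div_neg_of_pos_of_neg hs.gram_pos hs.one_sub_sq_neg

theorem Shape.Hyperbolic.le_sq_y {s : Shape} (hs : s.Hyperbolic) : 1 - s.hsq ≤ s.y ^ 2 := by
  have h := s.sq_form_line hs.one_sub_sq_neg.ne (u := 0) (v := 1) (by norm_num)
  have := div_nonpos_of_nonneg_of_nonpos
    (sq_nonneg ((s.z - s.x * s.y) * 1 - (s.y - s.x * s.z) * 0)) hs.one_sub_sq_neg.le
  rw [zero_mul, zero_add, one_mul] at h
  linarith

/-- If v were on the other side, the reversed Cauchy–Schwarz inequality would make its form with b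
negative. This places the foot of the height on the correct sheet. -/
theorem zero_lt_of_form_pos (hκ : κ < 0) (b : ModelPlane κ) {v : Fin 3 → ℝ}
    (h1 : 0 < form κ v v) (h2 : 0 < form κ v b.vec) : 0 < v 0 := by
  by_contra! h0
  have hb := b.form_self
  have hb0 : 0 < b.vec 0 := b.2.2 hκ.le
  simp only [form] at h1 h2 hb
  have h3 : -(v 0 * b.vec 0) < κ * (v 1 * b.vec 1 + v 2 * b.vec 2) := by linarith
  have h4 : 0 ≤ -(v 0 * b.vec 0) := by nlinarith
  have h5 : (v 0 * b.vec 0) ^ 2 < (κ * (v 1 * b.vec 1 + v 2 * b.vec 2)) ^ 2 := by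
    rw [← neg_sq (v 0 * b.vec 0)]
    exact pow_lt_pow_left₀ h3 h4 two_ne_zero
  have h6 : (κ * (v 1 * b.vec 1 + v 2 * b.vec 2)) ^ 2 =
      (κ * (v 1 * v 1 + v 2 * v 2)) * (κ * (b.vec 1 * b.vec 1 + b.vec 2 * b.vec 2))
        - κ ^ 2 * (v 1 * b.vec 2 - v 2 * b.vec 1) ^ 2 := by ring
  have h7 : κ * (b.vec 1 * b.vec 1 + b.vec 2 * b.vec 2) ≤ 0 :=
    mul_nonpos_of_nonpos_of_nonneg hκ.le
      (add_nonneg (mul_self_nonneg (b.vec 1)) (mul_self_nonneg (b.vec 2)))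
  have h8 := mul_nonneg (sq_nonneg κ) (sq_nonneg (v 1 * b.vec 2 - v 2 * b.vec 1))
  have h9 := mul_le_mul_of_nonpos_right (show -(v 0 * v 0) ≤ κ * (v 1 * v 1 + v 2 * v 2) by
    linarith) h7
  have h10 : (v 0 * b.vec 0) ^ 2 = (v 0 * v 0) * (b.vec 0 * b.vec 0) := by ring
  have h11 : b.vec 0 * b.vec 0 = 1 - κ * (b.vec 1 * b.vec 1 + b.vec 2 * b.vec 2) := by linarith
  rw [h10, h11, h6] at h5
  nlinarith [mul_self_nonneg (v 0)]

theorem Triangle.height_of_neg (hκ : κ < 0) (T : Triangle κ) :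
    T.height = Real.arcosh √(1 - T.shape.hsq) / √(-κ) := by
  have hs := T.hyperbolic_shape hκ
  have hx := hs.one_sub_sq_neg
  have hρ : 0 < 1 - T.shape.hsq := by linarith [hs.hsq_neg]
  have hr := Real.sqrt_pos.2 hρ
  have hle : ∀ X ∈ geodesicLine T.B T.C, √(1 - T.shape.hsq) ≤ form κ T.A.vec X.vec := by
    intro X hX
    obtain ⟨u, v, h1, h2⟩ := T.exists_of_mem_line hX
    have h3 := T.shape.sq_form_line hx.ne h1
    refine Real.sqrt_le_iff.2 ⟨by linarith [one_le_form hκ T.A X], ?_⟩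
    have := div_nonpos_of_nonneg_of_nonpos (sq_nonneg ((T.shape.z - T.shape.x * T.shape.y) * v
      - (T.shape.y - T.shape.x * T.shape.z) * u)) hx.le
    rw [h2]
    linarith
  have hex : ∃ X ∈ geodesicLine T.B T.C, form κ T.A.vec X.vec = √(1 - T.shape.hsq) := by
    obtain ⟨u, v, h1, h2, h3⟩ := T.shape.foot hx.ne hρ
    have h4 : form κ (u • T.B.vec + v • T.C.vec) (u • T.B.vec + v • T.C.vec) = 1 := by
      rw [form_comb_self]; exact h1
    refine ⟨⟨u • T.B.vec + v • T.C.vec, h4, fun _ => ?_⟩, ?_, ?_⟩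
    · refine zero_lt_of_form_pos hκ T.B (by rw [h4]; exact one_pos) ?_
      rw [form_comb_left, T.B.form_self, mul_one, form_comm T.C.vec]
      change 0 < u + v * T.shape.x
      rw [h3]
      exact div_pos (by linarith [hs.z_gt]) hr
    · exact Submodule.mem_span_pair.2 ⟨u, v, rfl⟩
    · change form κ T.A.vec (u • T.B.vec + v • T.C.vec) = _
      rw [form_comb_right, form_comm T.A.vec T.C.vec]
      exact h2
  refine IsLeast.csInf_eq ⟨?_, ?_⟩
  · obtain ⟨X, hX, h⟩ := hex
    exact ⟨X, hX, by simp only [gdist, not_lt.2 hκ.le, hκ, if_true, if_false, h]⟩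
  · rintro _ ⟨X, hX, rfl⟩
    simp only [gdist, not_lt.2 hκ.le, hκ, if_true, if_false]
    exact div_le_div_of_nonneg_right
      ((Real.arcosh_le_arcosh hr (by linarith [one_le_form hκ T.A X])).2 (hle X hX))
      (Real.sqrt_nonneg _)

theorem mul_cos_le_sin {t : ℝ} (h0 : 0 ≤ t) (h1 : t ≤ Real.pi / 2) :
    t * Real.cos t ≤ Real.sin t := by
  rcases h1.eq_or_lt with rfl | h
  · simp
  · have hc : 0 < Real.cos t := Real.cos_pos_of_mem_Ioo ⟨by linarith [Real.pi_pos], h⟩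
    have := Real.le_tan h0 h
    rwa [Real.tan_eq_sin_div_cos, le_div_iff₀ hc] at this

theorem sinh_le_mul_cosh {t : ℝ} (h0 : 0 ≤ t) : Real.sinh t ≤ t * Real.cosh t := by
  have hd : ∀ x, HasDerivAt (fun x => x * Real.cosh x - Real.sinh x) (x * Real.sinh x) x := by
    intro x
    exact (((hasDerivAt_id' x).mul (Real.hasDerivAt_cosh x)).sub
      (Real.hasDerivAt_sinh x)).congr_deriv (by ring)
  have hm : MonotoneOn (fun x => x * Real.cosh x - Real.sinh x) (Set.Ici 0) := by
    refine monotoneOn_of_deriv_nonneg (convex_Ici 0)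
      (fun x _ => (hd x).continuousAt.continuousWithinAt)
      (fun x _ => (hd x).differentiableAt.differentiableWithinAt) fun x hx => ?_
    rw [interior_Ici] at hx
    rw [(hd x).deriv]
    exact mul_nonneg (le_of_lt hx) (Real.sinh_nonneg_iff.2 (le_of_lt hx))
  have := hm (Set.self_mem_Ici) (Set.mem_Ici.2 h0) h0
  simp only [Real.sinh_zero, zero_mul, sub_zero] at this
  linarith

/-- For the rescaled height t these are sin t ≤ t ≤ (π/2) sin t and t cos t ≤ sin t, with cos t at
least y. The second is for arbitrary triangles, the third is sharp for small ones. -/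
theorem Triangle.height_bounds_of_pos (hκ : 0 < κ) (T : Triangle κ) :
    √T.shape.hsq ≤ √κ * T.height ∧ √κ * T.height ≤ Real.pi / 2 * √T.shape.hsq ∧
      √κ * T.height * T.shape.y ≤ √T.shape.hsq := by
  have hs := T.spherical_shape hκ
  have hk : 0 < √κ := Real.sqrt_pos.2 hκ
  rw [T.height_of_pos hκ, mul_div_cancel₀ _ hk.ne']
  have hsin : Real.sin (Real.arccos √(1 - T.shape.hsq)) = √T.shape.hsq := by
    rw [Real.sin_arccos, Real.sq_sqrt (by linarith [hs.hsq_le_one])]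
    congr 1; ring
  have hcos : Real.cos (Real.arccos √(1 - T.shape.hsq)) = √(1 - T.shape.hsq) :=
    Real.cos_arccos (by linarith [Real.sqrt_nonneg (1 - T.shape.hsq)])
      (Real.sqrt_le_one.2 (by linarith [hs.hsq_pos]))
  have h0 := Real.arccos_nonneg √(1 - T.shape.hsq)
  have h1 : Real.arccos √(1 - T.shape.hsq) ≤ Real.pi / 2 :=
    Real.arccos_le_pi_div_two.2 (Real.sqrt_nonneg _)
  generalize Real.arccos √(1 - T.shape.hsq) = t at *
  refine ⟨hsin ▸ Real.sin_le h0, ?_, ?_⟩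
  · have := Real.mul_le_sin h0 h1
    rw [hsin] at this
    have hp := Real.pi_pos
    have h2 : t = Real.pi / 2 * (2 / Real.pi * t) := by field_simp
    rw [h2]
    exact mul_le_mul_of_nonneg_left this (by positivity)
  · refine le_trans (mul_le_mul_of_nonneg_left ?_ h0) (hsin ▸ mul_cos_le_sin h0 h1)
    rw [hcos]
    exact Real.le_sqrt_of_sq_le hs.sq_y_le

theorem Triangle.height_bounds_of_neg (hκ : κ < 0) (T : Triangle κ) :
    √(-κ) * T.height ≤ √(-T.shape.hsq) ∧
      √(-T.shape.hsq) ≤ √(-κ) * T.height * T.shape.y := by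
  have hs := T.hyperbolic_shape hκ
  have hk : 0 < √(-κ) := Real.sqrt_pos.2 (by linarith)
  rw [T.height_of_neg hκ, mul_div_cancel₀ _ hk.ne']
  have h1 : 1 ≤ √(1 - T.shape.hsq) := Real.one_le_sqrt.2 (by linarith [hs.hsq_neg])
  have hsin : Real.sinh (Real.arcosh √(1 - T.shape.hsq)) = √(-T.shape.hsq) := by
    rw [Real.sinh_arcosh h1, Real.sq_sqrt (by linarith [hs.hsq_neg])]
    congr 1; ring
  have hcos := Real.cosh_arcosh h1
  have h0 := Real.arcosh_nonneg h1
  generalize Real.arcosh √(1 - T.shape.hsq) = t at *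
  refine ⟨hsin ▸ Real.self_le_sinh_iff.2 h0, ?_⟩
  rw [← hsin]
  refine (sinh_le_mul_cosh h0).trans (mul_le_mul_of_nonneg_left ?_ h0)
  rw [hcos]
  exact Real.sqrt_le_iff.2 ⟨by linarith [hs.y_gt], hs.le_sq_y⟩

theorem Triangle.height_pos_of_ne (hκ : κ ≠ 0) (T : Triangle κ) : 0 < T.height := by
  rcases hκ.lt_or_gt with h | h
  · have hs := T.hyperbolic_shape h
    have h1 : 0 < √(-T.shape.hsq) := Real.sqrt_pos.2 (by linarith [hs.hsq_neg])
    have h2 := h1.trans_le (T.height_bounds_of_neg h).2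
    exact pos_of_mul_pos_right (pos_of_mul_pos_left h2 (by linarith [hs.y_gt]))
      (Real.sqrt_nonneg _)
  · have h1 : 0 < √T.shape.hsq := Real.sqrt_pos.2 (T.spherical_shape h).hsq_pos
    exact pos_of_mul_pos_right (h1.trans_le (T.height_bounds_of_pos h).1) (Real.sqrt_nonneg _)

/-! ### Sharp bounds for nested sequences -/

theorem two_pow_mul_sqrt (n : ℕ) (a : ℝ) : 2 ^ n * √a = √(4 ^ n * a) := by
  have : (4 : ℝ) ^ n = (2 ^ n) ^ 2 := by rw [← pow_mul, mul_comm, pow_mul]; norm_num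
  rw [this, Real.sqrt_mul (by positivity), Real.sqrt_sq (by positivity)]

theorem exp_two_mul_mul_sqrt (d a : ℝ) :
    Real.exp (2 * d) * √a = √(Real.exp (4 * d) * a) := by
  have : Real.exp (4 * d) = Real.exp (2 * d) ^ 2 := by
    rw [← Real.exp_nat_mul]; congr 1; push_cast; ring
  rw [this, Real.sqrt_mul (by positivity), Real.sqrt_sq (by positivity)]

theorem IsNested.isNestedShape (hκ : κ ≠ 0) {t : ℕ → Triangle κ} (ht : IsNested t) :
    IsNestedShape fun n => (t n).shape := fun n =>
  let ⟨k, hk⟩ := ht n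
  ⟨k, (hk.shape_eq hκ).1⟩

theorem le_of_mul_le_exp {a b c d : ℝ} (hc : 0 < c)
    (h : Real.exp (-(2 * d)) * (c * a) ≤ Real.exp (2 * d) * (c * b)) :
    Real.exp (-(4 * d)) * a ≤ b := by
  have e : Real.exp (-(4 * d)) = Real.exp (-(2 * d)) * Real.exp (-(2 * d)) := by
    rw [← Real.exp_add]; congr 1; ring
  have e2 : Real.exp (-(2 * d)) * Real.exp (2 * d) = 1 := by
    rw [← Real.exp_add]; simp
  refine le_of_mul_le_mul_left ?_ hc
  calc c * (Real.exp (-(4 * d)) * a) = Real.exp (-(2 * d)) * (Real.exp (-(2 * d)) * (c * a)) := by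
        rw [e]; ring
    _ ≤ Real.exp (-(2 * d)) * (Real.exp (2 * d) * (c * b)) := by gcongr
    _ = c * b := by rw [← mul_assoc, e2, one_mul]

theorem le_exp_of_mul_le {a b d : ℝ} (h : Real.exp (-(4 * d)) * a ≤ b) :
    a ≤ Real.exp (4 * d) * b := by
  rwa [Real.exp_neg, inv_mul_le_iff₀ (Real.exp_pos _)] at h

/-- The sharp bounds for hyperbolic triangles. -/
theorem IsNested.sharp_of_neg (hκ : κ < 0) {t : ℕ → Triangle κ} (ht : IsNested t) (n : ℕ) :
    Real.exp (-(4 * (t 0).shape.defect)) * (t 0).height ≤ 2 ^ n * (t n).height ∧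
      2 ^ n * (t n).height ≤ Real.exp (4 * (t 0).shape.defect) * (t 0).height := by
  have hk : 0 < √(-κ) := Real.sqrt_pos.2 (by linarith)
  obtain ⟨hd, h1, h2⟩ := (ht.isNestedShape hκ.ne).hyperbolic_bounds
    (fun n => (t n).hyperbolic_shape hκ) n
  set d := (t 0).shape.defect
  have hd0 : 0 ≤ d := (t 0).shape.defect_nonneg
  -- Of exp(4d), half comes from the square root of the `hsq` bounds and half from this passage
  -- between t and sinh t; the converse passage is lossless.
  have key : ∀ n, (t n).shape.defect ≤ d →
      √(-(t n).shape.hsq) ≤ Real.exp (2 * d) * (√(-κ) * (t n).height) := by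
    intro n hn
    refine ((t n).height_bounds_of_neg hκ).2.trans ?_
    rw [mul_comm]
    refine mul_le_mul_of_nonneg_right ?_ (mul_pos hk ((t n).height_pos_of_ne hκ.ne)).le
    have := (abs_le.1 (t n).shape.abs_one_sub_y_le).1
    linarith [Real.add_one_le_exp (2 * d)]
  have k0 := key 0 le_rfl
  have kn := key n hd
  have g0 := ((t 0).height_bounds_of_neg hκ).1
  have gn := ((t n).height_bounds_of_neg hκ).1
  have a1 : Real.exp (-(2 * d)) * √(-(t 0).shape.hsq) ≤ 2 ^ n * √(-(t n).shape.hsq) := by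
    rw [two_pow_mul_sqrt, show -(2 * d) = 2 * -d by ring, exp_two_mul_mul_sqrt,
      show 4 * -d = -(4 * d) by ring]
    exact Real.sqrt_le_sqrt h1
  have a2 : 2 ^ n * √(-(t n).shape.hsq) ≤ Real.exp (2 * d) * √(-(t 0).shape.hsq) := by
    rw [two_pow_mul_sqrt, exp_two_mul_mul_sqrt]
    exact Real.sqrt_le_sqrt h2
  constructor
  · refine le_of_mul_le_exp hk ?_
    calc _ ≤ Real.exp (-(2 * d)) * √(-(t 0).shape.hsq) := by gcongr
      _ ≤ 2 ^ n * √(-(t n).shape.hsq) := a1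
      _ ≤ 2 ^ n * (Real.exp (2 * d) * (√(-κ) * (t n).height)) := by gcongr
      _ = _ := by ring
  · refine le_exp_of_mul_le (le_of_mul_le_exp hk ?_)
    rw [Real.exp_neg, inv_mul_le_iff₀ (Real.exp_pos _)]
    calc _ = 2 ^ n * (√(-κ) * (t n).height) := by ring
      _ ≤ 2 ^ n * √(-(t n).shape.hsq) := by gcongr
      _ ≤ Real.exp (2 * d) * √(-(t 0).shape.hsq) := a2
      _ ≤ _ := by gcongr

/-- The sharp bounds for small spherical triangles. -/
theorem IsNested.sharp_of_pos (hκ : 0 < κ) {t : ℕ → Triangle κ} (ht : IsNested t)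
    (hsmall : (t 0).shape.defect ≤ 1 / 2) (n : ℕ) :
    Real.exp (-(4 * (t 0).shape.defect)) * (t 0).height ≤ 2 ^ n * (t n).height ∧
      2 ^ n * (t n).height ≤ Real.exp (4 * (t 0).shape.defect) * (t 0).height := by
  have hk : 0 < √κ := Real.sqrt_pos.2 hκ
  obtain ⟨hd, h1, h2⟩ := (ht.isNestedShape hκ.ne').spherical_bounds
    (fun n => (t n).spherical_shape hκ) (hsmall.trans (by norm_num)) n
  set d := (t 0).shape.defect
  have hd0 : 0 ≤ d := (t 0).shape.defect_nonneg
  have key : ∀ n, (t n).shape.defect ≤ d →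
      √κ * (t n).height ≤ Real.exp (2 * d) * √(t n).shape.hsq := by
    intro n hn
    have h := ((t n).height_bounds_of_pos hκ).2.2
    -- Here 2d ≤ 1 is needed, whence the threshold 1/2.
    have h3 : Real.exp (-(2 * d)) ≤ (t n).shape.y := by
      have := (abs_le.1 (t n).shape.abs_one_sub_y_le).2
      linarith [exp_neg_le_one_sub_half (x := 2 * d) (by linarith) (by linarith)]
    rw [← inv_mul_le_iff₀ (Real.exp_pos _), ← Real.exp_neg, mul_comm]
    exact (mul_le_mul_of_nonneg_left h3
      (mul_pos hk ((t n).height_pos_of_ne hκ.ne')).le).trans h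
  have k0 := key 0 le_rfl
  have kn := key n hd
  have g0 := ((t 0).height_bounds_of_pos hκ).1
  have gn := ((t n).height_bounds_of_pos hκ).1
  have a1 : Real.exp (-(2 * d)) * √(t 0).shape.hsq ≤ 2 ^ n * √(t n).shape.hsq := by
    rw [two_pow_mul_sqrt, show -(2 * d) = 2 * -d by ring, exp_two_mul_mul_sqrt,
      show 4 * -d = -(4 * d) by ring]
    exact Real.sqrt_le_sqrt h1
  have a2 : 2 ^ n * √(t n).shape.hsq ≤ Real.exp (2 * d) * √(t 0).shape.hsq := by
    rw [two_pow_mul_sqrt, exp_two_mul_mul_sqrt]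
    exact Real.sqrt_le_sqrt h2
  have a1' : √(t 0).shape.hsq ≤ Real.exp (2 * d) * (2 ^ n * √(t n).shape.hsq) := by
    rwa [Real.exp_neg, inv_mul_le_iff₀ (Real.exp_pos _)] at a1
  constructor
  · refine le_of_mul_le_exp hk ?_
    rw [Real.exp_neg, inv_mul_le_iff₀ (Real.exp_pos _)]
    calc _ ≤ Real.exp (2 * d) * √(t 0).shape.hsq := k0
      _ ≤ Real.exp (2 * d) * (Real.exp (2 * d) * (2 ^ n * √(t n).shape.hsq)) := by gcongr
      _ ≤ Real.exp (2 * d) * (Real.exp (2 * d) * (2 ^ n * (√κ * (t n).height))) := by gcongr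
      _ = _ := by ring
  · refine le_exp_of_mul_le (le_of_mul_le_exp hk ?_)
    rw [Real.exp_neg, inv_mul_le_iff₀ (Real.exp_pos _)]
    calc _ = 2 ^ n * (√κ * (t n).height) := by ring
      _ ≤ 2 ^ n * (Real.exp (2 * d) * √(t n).shape.hsq) := by gcongr
      _ = Real.exp (2 * d) * (2 ^ n * √(t n).shape.hsq) := by ring
      _ ≤ Real.exp (2 * d) * (Real.exp (2 * d) * √(t 0).shape.hsq) := by gcongr
      _ ≤ _ := by gcongr

/-! ### Coarse bounds for arbitrary spherical triangles -/

theorem form_sq_le (hκ : 0 < κ) (w : ModelPlane κ) (v : Fin 3 → ℝ) :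
    form κ w.vec v ^ 2 ≤ form κ v v := by
  have h := form_self_nonneg hκ ((1 : ℝ) • v + (-form κ w.vec v) • w.vec)
  rw [form_comb_left, form_comb_right, form_comb_right, w.form_self, form_comm v w.vec] at h
  linarith

/-- Cauchy–Schwarz against p + q, whose norm is twice the half-angle cosine. -/
theorem form_add_form_le (hκ : 0 < κ) (w p q : ModelPlane κ) :
    form κ w.vec p.vec + form κ w.vec q.vec ≤ 2 * halfCos (form κ p.vec q.vec) := by
  have h := form_sq_le hκ w ((1 : ℝ) • p.vec + (1 : ℝ) • q.vec)
  rw [form_comb_self, form_comb_right] at h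
  have h1 : (form κ w.vec p.vec + form κ w.vec q.vec) / 2 ≤ halfCos (form κ p.vec q.vec) :=
    Real.le_sqrt_of_sq_le (by linarith)
  linarith

theorem Triangle.exists_center (hκ : 0 < κ) (T : Triangle κ) :
    ∃ w : ModelPlane κ, 0 < form κ w.vec T.A.vec ∧ 0 < form κ w.vec T.B.vec ∧
      0 < form κ w.vec T.C.vec := by
  obtain ⟨u, hA, hB, hC⟩ := T.hemisphere hκ
  -- Division by κ turns the dot product with u into the form with v; normalizing v gives a point of
  -- the surface.
  set v : Fin 3 → ℝ := ![u 0, u 1 / κ, u 2 / κ] with hv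
  have e : ∀ p : Fin 3 → ℝ, form κ v p = u ⬝ᵥ p := by
    intro p
    simp only [form, hv, dotProduct, Fin.sum_univ_three, Matrix.cons_val]
    field_simp
    ring
  have hN : 0 < form κ v v := by
    have h := form_sq_le hκ T.A v
    rw [form_comm, e] at h
    exact (pow_pos hA 2).trans_le h
  have hr := Real.sqrt_pos.2 hN
  have e2 : ∀ p : Fin 3 → ℝ, form κ ((√(form κ v v))⁻¹ • v) p = (√(form κ v v))⁻¹ * u ⬝ᵥ p := by
    intro p
    rw [← e]
    simp only [form, Pi.smul_apply, smul_eq_mul]; ring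
  refine ⟨⟨(√(form κ v v))⁻¹ • v, ?_, fun h => absurd hκ (not_lt.2 h)⟩, ?_, ?_, ?_⟩
  · rw [e2, ← e, form_comm v (_ • v), e2, ← e, ← mul_assoc, ← sq, inv_pow, Real.sq_sqrt hN.le,
      inv_mul_cancel₀ hN.ne']
  all_goals
    change 0 < form κ ((√(form κ v v))⁻¹ • v) _
    rw [e2]
    positivity

/-- Coarse bounds for arbitrary spherical triangles. -/
theorem Triangle.coarse_of_pos (hκ : 0 < κ) (T : Triangle κ) :
    ∃ K, 0 < K ∧ ∀ t : ℕ → Triangle κ, IsNested t → t 0 = T → ∀ n,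
      K * T.height ≤ 2 ^ n * (t n).height ∧ K * (2 ^ n * (t n).height) ≤ T.height := by
  obtain ⟨w, hA, hB, hC⟩ := T.exists_center hκ
  set m := min (form κ w.vec T.A.vec) (min (form κ w.vec T.B.vec) (form κ w.vec T.C.vec))
  have hm : 0 < m := lt_min hA (lt_min hB hC)
  have hm1 : m ≤ 1 := (min_le_left _ _).trans (form_le_one hκ _ _)
  obtain ⟨c, hc, H⟩ := IsWeightedNested.exists_bounds hm hm1 (chartSize T.shape (T.weights w.vec))
  have hk : 0 < √κ := Real.sqrt_pos.2 hκ
  have hπ := Real.pi_pos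
  refine ⟨2 / Real.pi * √c, mul_pos (by positivity) (Real.sqrt_pos.2 hc), fun t ht h0 n => ?_⟩
  subst h0
  have hW : IsWeightedNested m (fun n => (t n).shape) (fun n => (t n).weights w.vec) := by
    refine ⟨fun n => ?_, fun n => (t n).spherical_shape hκ, fun n => form_le_one hκ _ _,
      fun n => form_le_one hκ _ _, fun n => form_le_one hκ _ _, fun n => form_add_form_le hκ _ _ _,
      fun n => form_add_form_le hκ _ _ _, fun n => form_add_form_le hκ _ _ _, ?_⟩
    · obtain ⟨k, hk⟩ := ht n
      exact ⟨k, (hk.shape_eq hκ.ne').1, (hk.shape_eq hκ.ne').2 _⟩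
    · exact ⟨min_le_left _ _, form_le_one hκ _ _, (min_le_right _ _).trans (min_le_left _ _),
        form_le_one hκ _ _, (min_le_right _ _).trans (min_le_right _ _), form_le_one hκ _ _⟩
  obtain ⟨h1, h2⟩ := H _ _ hW le_rfl n
  have a1 : √c * √(t 0).shape.hsq ≤ 2 ^ n * √(t n).shape.hsq := by
    rw [two_pow_mul_sqrt, ← Real.sqrt_mul hc.le]
    exact Real.sqrt_le_sqrt h1
  have a2 : √c * (2 ^ n * √(t n).shape.hsq) ≤ √(t 0).shape.hsq := by
    rw [two_pow_mul_sqrt, ← Real.sqrt_mul hc.le]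
    exact Real.sqrt_le_sqrt h2
  obtain ⟨u0, v0, -⟩ := (t 0).height_bounds_of_pos hκ
  obtain ⟨un, vn, -⟩ := (t n).height_bounds_of_pos hκ
  have key : ∀ x y : ℝ, x ≤ Real.pi / 2 * y → 2 / Real.pi * x ≤ y := by
    intro x y h
    calc 2 / Real.pi * x ≤ 2 / Real.pi * (Real.pi / 2 * y) := by gcongr
      _ = y := by field_simp
  constructor
  · refine le_of_mul_le_mul_left ?_ hk
    calc √κ * (2 / Real.pi * √c * (t 0).height)
        = √c * (2 / Real.pi * (√κ * (t 0).height)) := by ring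
      _ ≤ √c * √(t 0).shape.hsq := by gcongr; exact key _ _ v0
      _ ≤ 2 ^ n * √(t n).shape.hsq := a1
      _ ≤ 2 ^ n * (√κ * (t n).height) := by gcongr
      _ = _ := by ring
  · refine le_of_mul_le_mul_left ?_ hk
    calc √κ * (2 / Real.pi * √c * (2 ^ n * (t n).height))
        = √c * (2 ^ n * (2 / Real.pi * (√κ * (t n).height))) := by ring
      _ ≤ √c * (2 ^ n * √(t n).shape.hsq) := by gcongr; exact key _ _ vn
      _ ≤ √(t 0).shape.hsq := a2
      _ ≤ _ := u0

/-! ### The Euclidean plane -/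

theorem ModelPlane.vec_zero (p : ModelPlane 0) : p.vec 0 = 1 := by
  have h := p.form_self
  have h0 : 0 < p.vec 0 := p.2.2 le_rfl
  simp only [form, zero_mul, add_zero] at h
  nlinarith

theorem gdist_zero (p q : ModelPlane 0) :
    gdist p q = √((p.vec 1 - q.vec 1) ^ 2 + (p.vec 2 - q.vec 2) ^ 2) := by
  simp [gdist]

theorem IsMidpoint.vec_eq {m p q : ModelPlane 0} (h : IsMidpoint m p q) (i : Fin 3) :
    m.vec i = (p.vec i + q.vec i) / 2 := by
  obtain ⟨h1, h2⟩ := h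
  rw [gdist_zero, gdist_zero] at h1 h2
  have hd : 0 ≤ (p.vec 1 - q.vec 1) ^ 2 + (p.vec 2 - q.vec 2) ^ 2 := by positivity
  have e1 : (p.vec 1 - m.vec 1) ^ 2 + (p.vec 2 - m.vec 2) ^ 2 =
      ((p.vec 1 - q.vec 1) ^ 2 + (p.vec 2 - q.vec 2) ^ 2) / 4 := by
    rw [← Real.sq_sqrt (show 0 ≤ (p.vec 1 - m.vec 1) ^ 2 + (p.vec 2 - m.vec 2) ^ 2 by positivity),
      h1, div_pow, Real.sq_sqrt hd]
    norm_num
  have e2 : (m.vec 1 - q.vec 1) ^ 2 + (m.vec 2 - q.vec 2) ^ 2 =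
      ((p.vec 1 - q.vec 1) ^ 2 + (p.vec 2 - q.vec 2) ^ 2) / 4 := by
    rw [← Real.sq_sqrt (show 0 ≤ (m.vec 1 - q.vec 1) ^ 2 + (m.vec 2 - q.vec 2) ^ 2 by positivity),
      h2, div_pow, Real.sq_sqrt hd]
    norm_num
  -- The parallelogram law: |m - (p + q)/2|² = |p - m|²/2 + |m - q|²/2 - |p - q|²/4.
  have e3 : (m.vec 1 - (p.vec 1 + q.vec 1) / 2) ^ 2
      + (m.vec 2 - (p.vec 2 + q.vec 2) / 2) ^ 2 = 0 := by
    linear_combination (1 / 2) * e1 + (1 / 2) * e2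
  have e4 : (m.vec 1 - (p.vec 1 + q.vec 1) / 2) ^ 2 = 0 := by
    linarith [sq_nonneg (m.vec 1 - (p.vec 1 + q.vec 1) / 2),
      sq_nonneg (m.vec 2 - (p.vec 2 + q.vec 2) / 2)]
  have e5 : (m.vec 2 - (p.vec 2 + q.vec 2) / 2) ^ 2 = 0 := by linarith
  have e6 := pow_eq_zero_iff two_ne_zero |>.1 e4
  have e7 := pow_eq_zero_iff two_ne_zero |>.1 e5
  fin_cases i
  · change m.vec 0 = (p.vec 0 + q.vec 0) / 2
    rw [m.vec_zero, p.vec_zero, q.vec_zero]; norm_num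
  · change m.vec 1 = (p.vec 1 + q.vec 1) / 2
    linarith
  · change m.vec 2 = (p.vec 2 + q.vec 2) / 2
    linarith

/-- The squared length of the side `BC` of a Euclidean triangle. -/
def Triangle.sqSide (T : Triangle 0) : ℝ :=
  (T.B.vec 1 - T.C.vec 1) ^ 2 + (T.B.vec 2 - T.C.vec 2) ^ 2

theorem Triangle.sqSide_pos (T : Triangle 0) : 0 < T.sqSide := by
  refine lt_of_le_of_ne (by rw [sqSide]; positivity) fun h => T.det_ne_zero ?_
  rw [sqSide] at h
  have e1 : (T.B.vec 1 - T.C.vec 1) ^ 2 = 0 := by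
    linarith [sq_nonneg (T.B.vec 1 - T.C.vec 1), sq_nonneg (T.B.vec 2 - T.C.vec 2)]
  have e2 : (T.B.vec 2 - T.C.vec 2) ^ 2 = 0 := by linarith
  have e3 : T.B.vec 1 = T.C.vec 1 := by linarith [pow_eq_zero_iff two_ne_zero |>.1 e1]
  have e4 : T.B.vec 2 = T.C.vec 2 := by linarith [pow_eq_zero_iff two_ne_zero |>.1 e2]
  rw [T.det_eq, T.A.vec_zero, T.B.vec_zero, T.C.vec_zero, e3, e4]
  ring

/-- The height is twice the area, |`det`|, over the base; `key` is Pythagoras multiplied by the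
squared base. -/
theorem Triangle.height_zero (T : Triangle 0) : T.height = √(T.det ^ 2 / T.sqSide) := by
  have hs := T.sqSide_pos
  have hA := T.A.vec_zero
  have hB := T.B.vec_zero
  have hC := T.C.vec_zero
  have key : ∀ u v : ℝ, u + v = 1 →
      ((T.A.vec 1 - (u * T.B.vec 1 + v * T.C.vec 1)) ^ 2 +
        (T.A.vec 2 - (u * T.B.vec 2 + v * T.C.vec 2)) ^ 2) * T.sqSide = T.det ^ 2 +
      ((T.A.vec 1 - T.B.vec 1) * (T.C.vec 1 - T.B.vec 1) +
        (T.A.vec 2 - T.B.vec 2) * (T.C.vec 2 - T.B.vec 2) - v * T.sqSide) ^ 2 := by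
    intro u v h
    obtain rfl : u = 1 - v := by linarith
    rw [T.det_eq, sqSide, hA, hB, hC]
    ring
  refine IsLeast.csInf_eq ⟨?_, ?_⟩
  · set v := ((T.A.vec 1 - T.B.vec 1) * (T.C.vec 1 - T.B.vec 1) +
        (T.A.vec 2 - T.B.vec 2) * (T.C.vec 2 - T.B.vec 2)) / T.sqSide with hv
    have h0 : ((1 - v) • T.B.vec + v • T.C.vec) 0 = 1 := by
      simp only [Pi.add_apply, Pi.smul_apply, smul_eq_mul, hB, hC]; ring
    refine ⟨⟨(1 - v) • T.B.vec + v • T.C.vec, ?_, fun _ => ?_⟩, ?_, ?_⟩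
    · rw [form, h0]; norm_num
    · rw [h0]; exact one_pos
    · exact Submodule.mem_span_pair.2 ⟨_, _, rfl⟩
    · refine (gdist_zero _ _).trans (congrArg Real.sqrt ?_)
      rw [eq_div_iff hs.ne']
      refine (key (1 - v) v (by ring)).trans ?_
      rw [hv, div_mul_cancel₀ _ hs.ne']
      ring
  · rintro _ ⟨X, hX, rfl⟩
    obtain ⟨u, v, h⟩ := Submodule.mem_span_pair.1 hX
    have hi : ∀ i, X.vec i = u * T.B.vec i + v * T.C.vec i := fun i => by
      rw [← h]; rfl
    have huv : u + v = 1 := by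
      have := hi 0
      rw [X.vec_zero, hB, hC] at this
      linarith
    rw [gdist_zero]
    refine Real.sqrt_le_sqrt ?_
    rw [div_le_iff₀ hs, hi, hi, key u v huv]
    exact le_add_of_nonneg_right (sq_nonneg _)

theorem Triangle.height_pos_of_zero (T : Triangle 0) : 0 < T.height := by
  rw [T.height_zero]
  have h1 := T.det_ne_zero
  have h2 := T.sqSide_pos
  exact Real.sqrt_pos.2 (by positivity)

theorem IsMedialPiece.height_zero {k : Piece} {S T : Triangle 0} (h : IsMedialPiece k S T) :
    2 * T.height = S.height := by
  obtain ⟨D, E, F, hD, hE, hF, hk⟩ := h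
  have key : T.det ^ 2 = S.det ^ 2 / 16 ∧ T.sqSide = S.sqSide / 4 := by
    cases k with
    | inner =>
      obtain ⟨hA, hB, hC⟩ := hk
      simp only [Triangle.det_eq, Triangle.sqSide, hA, hB, hC, hD.vec_eq, hE.vec_eq, hF.vec_eq]
      constructor <;> ring
    | outerA =>
      obtain ⟨hA, hB, hC⟩ := hk
      simp only [Triangle.det_eq, Triangle.sqSide, hA, hB, hC, hE.vec_eq, hF.vec_eq]
      constructor <;> ring
    | outerB =>
      obtain ⟨hA, hB, hC⟩ := hk
      simp only [Triangle.det_eq, Triangle.sqSide, hA, hB, hC, hD.vec_eq, hF.vec_eq]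
      constructor <;> ring
    | outerC =>
      obtain ⟨hA, hB, hC⟩ := hk
      simp only [Triangle.det_eq, Triangle.sqSide, hA, hB, hC, hE.vec_eq, hD.vec_eq]
      constructor <;> ring
  have e : S.det ^ 2 / S.sqSide = 2 ^ 2 * (S.det ^ 2 / 16 / (S.sqSide / 4)) := by
    have := S.sqSide_pos
    field_simp
    ring
  rw [T.height_zero, S.height_zero, key.1, key.2, e, Real.sqrt_mul (by norm_num),
    Real.sqrt_sq (by norm_num)]

theorem IsNested.height_zero {t : ℕ → Triangle 0} (ht : IsNested t) (n : ℕ) :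
    2 ^ n * (t n).height = (t 0).height := by
  induction n with
  | zero => simp
  | succ n ih =>
    obtain ⟨k, hk⟩ := ht n
    rw [← ih, ← hk.height_zero]
    ring

/-! ### Limits and choice of the constants -/

theorem gdist_nonneg (p q : ModelPlane κ) : 0 ≤ gdist p q := by
  rw [gdist]
  split_ifs with h1 h2
  · exact div_nonneg (Real.arccos_nonneg _) (Real.sqrt_nonneg _)
  · exact div_nonneg (Real.arcosh_nonneg (one_le_form h2 p q)) (Real.sqrt_nonneg _)
  · exact Real.sqrt_nonneg _

theorem exists_form_eq (hκ : κ ≠ 0) :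
    ∃ φ : ℝ → ℝ, Continuous φ ∧ φ 0 = 1 ∧
      ∀ p q : ModelPlane κ, form κ p.vec q.vec = φ (gdist p q) := by
  rcases hκ.lt_or_gt with hκ | hκ
  · have hs : √(-κ) ≠ 0 := (Real.sqrt_pos.2 (by linarith)).ne'
    refine ⟨fun d => Real.cosh (√(-κ) * d), by fun_prop, by simp, fun p q => ?_⟩
    simp only [gdist, not_lt.2 hκ.le, hκ, if_true, if_false]
    rw [mul_div_cancel₀ _ hs, Real.cosh_arcosh (one_le_form hκ p q)]
  · have hs : √κ ≠ 0 := (Real.sqrt_pos.2 hκ).ne'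
    refine ⟨fun d => Real.cos (√κ * d), by fun_prop, by simp, fun p q => ?_⟩
    simp only [gdist, hκ, if_true]
    rw [mul_div_cancel₀ _ hs, Real.cos_arccos (neg_one_le_form hκ p q) (form_le_one hκ p q)]

theorem tendsto_maxSide : Tendsto Triangle.maxSide (sidesToZero κ) (𝓝 0) := tendsto_comap

theorem tendsto_defect (hκ : κ ≠ 0) :
    Tendsto (fun T : Triangle κ => T.shape.defect) (sidesToZero κ) (𝓝 0) := by
  obtain ⟨φ, hφ, h0, h⟩ := exists_form_eq hκ
  have key : ∀ f : Triangle κ → ℝ, (∀ T, 0 ≤ f T) → (∀ T, f T ≤ T.maxSide) →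
      Tendsto (fun T => |1 - φ (f T)|) (sidesToZero κ) (𝓝 0) := by
    intro f h1 h2
    have h3 : Tendsto f (sidesToZero κ) (𝓝 0) := squeeze_zero h1 h2 tendsto_maxSide
    have h4 : Continuous fun d => |1 - φ d| := by fun_prop
    have h5 := (h4.tendsto 0).comp h3
    rwa [h0, sub_self, abs_zero] at h5
  have ha := key Triangle.a (fun T => gdist_nonneg _ _) (fun T => le_max_left _ _)
  have hb := key Triangle.b (fun T => gdist_nonneg _ _)
    (fun T => (le_max_left _ _).trans (le_max_right _ _))
  have hc := key Triangle.c (fun T => gdist_nonneg _ _)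
    (fun T => (le_max_right _ _).trans (le_max_right _ _))
  have := ha.max (hb.max hc)
  simp only [max_self] at this
  simpa only [Shape.defect, Triangle.shape, h, Triangle.a, Triangle.b, Triangle.c] using this

theorem Triangle.defect_pos (hκ : κ ≠ 0) (T : Triangle κ) : 0 < T.shape.defect := by
  refine lt_of_lt_of_le (abs_pos.2 fun e => ?_) T.shape.abs_one_sub_x_le
  rcases hκ.lt_or_gt with h | h
  · linarith [(T.hyperbolic_shape h).x_gt]
  · linarith [(T.spherical_shape h).x_lt]

theorem Triangle.maxSide_pos (T : Triangle 0) : 0 < T.maxSide := by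
  refine lt_of_lt_of_le ?_ (le_max_left _ _)
  rw [Triangle.a, gdist_zero]
  exact Real.sqrt_pos.2 T.sqSide_pos

/-- Sharp bounds for small triangles and coarse bounds for all triangles give the distortion
bounds of the theorem. -/
theorem exists_distortion (δ : Triangle κ → ℝ) (hδ : ∀ T, 0 < δ T)
    (hlim : Tendsto δ (sidesToZero κ) (𝓝 0)) (hpos : ∀ T : Triangle κ, 0 < T.height)
    (hcoarse : ∀ T : Triangle κ, ∃ K, 0 < K ∧ ∀ t : ℕ → Triangle κ, IsNested t → t 0 = T → ∀ n,
      K * T.height ≤ 2 ^ n * (t n).height ∧ K * (2 ^ n * (t n).height) ≤ T.height)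
    (hsharp : ∀ t : ℕ → Triangle κ, IsNested t → δ (t 0) ≤ 1 / 2 → ∀ n,
      Real.exp (-(4 * δ (t 0))) * (t 0).height ≤ 2 ^ n * (t n).height ∧
        2 ^ n * (t n).height ≤ Real.exp (4 * δ (t 0)) * (t 0).height) :
    ∃ l L : Triangle κ → ℝ, (∀ T, 0 < l T ∧ 0 < L T) ∧
      (∀ t : ℕ → Triangle κ, IsNested t → ∀ n : ℕ,
        (t 0).height * l (t 0) < 2 ^ n * (t n).height ∧
          2 ^ n * (t n).height < (t 0).height * L (t 0)) ∧
      Tendsto l (sidesToZero κ) (𝓝[<] 1) ∧ Tendsto L (sidesToZero κ) (𝓝[>] 1) := by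
  choose K hK hKt using hcoarse
  have hev : ∀ᶠ T in sidesToZero κ, δ T ≤ 1 / 2 := hlim.eventually_le_const (by norm_num)
  -- Strictness comes from 5 in place of 4 in the exponents and from the factors 2 around K; the
  -- limits only involve the first branch.
  refine ⟨fun T => if δ T ≤ 1 / 2 then Real.exp (-(5 * δ T)) else K T / 2,
    fun T => if δ T ≤ 1 / 2 then Real.exp (5 * δ T) else 2 / K T, fun T => ?_, fun t ht n => ?_,
    ?_, ?_⟩
  · have := hK T
    constructor <;> dsimp only <;> split_ifs <;> positivity
  · have hh := hpos (t 0)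
    have hd := hδ (t 0)
    dsimp only
    split_ifs with h
    · obtain ⟨h1, h2⟩ := hsharp t ht h n
      constructor
      · refine lt_of_lt_of_le ?_ h1
        rw [mul_comm]
        exact mul_lt_mul_of_pos_right (Real.exp_lt_exp.2 (by linarith)) hh
      · refine lt_of_le_of_lt h2 ?_
        rw [mul_comm]
        exact mul_lt_mul_of_pos_left (Real.exp_lt_exp.2 (by linarith)) hh
    · obtain ⟨h1, h2⟩ := hKt (t 0) t ht rfl n
      have hk := hK (t 0)
      constructor
      · nlinarith [mul_pos hk hh]
      · rw [mul_div_assoc', lt_div_iff₀ hk]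
        linarith
  · refine tendsto_nhdsWithin_iff.2 ⟨?_, ?_⟩
    · have h1 : Tendsto (fun T => Real.exp (-(5 * δ T))) (sidesToZero κ) (𝓝 1) := by
        have := (Real.continuous_exp.tendsto _).comp (hlim.const_mul 5).neg
        rwa [mul_zero, neg_zero, Real.exp_zero] at this
      refine h1.congr' ?_
      filter_upwards [hev] with T hT
      rw [if_pos hT]
    · filter_upwards [hev] with T hT
      rw [if_pos hT, Set.mem_Iio, Real.exp_lt_one_iff]
      linarith [hδ T]
  · refine tendsto_nhdsWithin_iff.2 ⟨?_, ?_⟩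
    · have h1 : Tendsto (fun T => Real.exp (5 * δ T)) (sidesToZero κ) (𝓝 1) := by
        have := (Real.continuous_exp.tendsto _).comp (hlim.const_mul 5)
        rwa [mul_zero, Real.exp_zero] at this
      refine h1.congr' ?_
      filter_upwards [hev] with T hT
      rw [if_pos hT]
    · filter_upwards [hev] with T hT
      rw [if_pos hT, Set.mem_Ioi, Real.one_lt_exp_iff]
      linarith [hδ T]

theorem Triangle.coarse_of_neg (hκ : κ < 0) (T : Triangle κ) :
    ∃ K, 0 < K ∧ ∀ t : ℕ → Triangle κ, IsNested t → t 0 = T → ∀ n,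
      K * T.height ≤ 2 ^ n * (t n).height ∧ K * (2 ^ n * (t n).height) ≤ T.height := by
  refine ⟨Real.exp (-(4 * T.shape.defect)), Real.exp_pos _, fun t ht h0 n => ?_⟩
  subst h0
  obtain ⟨h1, h2⟩ := ht.sharp_of_neg hκ n
  refine ⟨h1, ?_⟩
  rwa [Real.exp_neg, inv_mul_le_iff₀ (Real.exp_pos _)]

/-- The strict distortion bounds for the heights of all nested sequences of triangles. -/
theorem exists_strict_bounds (κ : ℝ) :
    ∃ l L : Triangle κ → ℝ, (∀ T, 0 < l T ∧ 0 < L T) ∧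
      (∀ t : ℕ → Triangle κ, IsNested t → ∀ n : ℕ,
        (t 0).height * l (t 0) < 2 ^ n * (t n).height ∧
          2 ^ n * (t n).height < (t 0).height * L (t 0)) ∧
      Tendsto l (sidesToZero κ) (𝓝[<] 1) ∧ Tendsto L (sidesToZero κ) (𝓝[>] 1) := by
  rcases lt_trichotomy κ 0 with hκ | rfl | hκ
  · exact exists_distortion (fun T => T.shape.defect) (fun T => T.defect_pos hκ.ne)
      (tendsto_defect hκ.ne) (fun T => T.height_pos_of_ne hκ.ne) (fun T => T.coarse_of_neg hκ)
      fun t ht _ n => ht.sharp_of_neg hκ n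
  -- Heights halve exactly, so any positive quantity tending to 0 can serve as δ.
  · refine exists_distortion Triangle.maxSide Triangle.maxSide_pos tendsto_maxSide
      Triangle.height_pos_of_zero (fun T => ⟨1, one_pos, fun t ht h0 n => ?_⟩) fun t ht _ n => ?_
    · rw [ht.height_zero, h0, one_mul]
      exact ⟨le_rfl, le_rfl⟩
    · rw [ht.height_zero]
      have h1 := (t 0).maxSide_pos
      have h2 := (t 0).height_pos_of_zero.le
      exact ⟨mul_le_of_le_one_left h2 (Real.exp_le_one_iff.2 (by linarith)),
        le_mul_of_one_le_left h2 (Real.one_le_exp (by linarith))⟩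
  · exact exists_distortion (fun T => T.shape.defect) (fun T => T.defect_pos hκ.ne')
      (tendsto_defect hκ.ne') (fun T => T.height_pos_of_ne hκ.ne') (fun T => T.coarse_of_pos hκ)
      fun t ht h n => ht.sharp_of_pos hκ h n

end MedialSubdivision

end

theorem proposition4p1 (κ : ℝ) :
    ∃ l L : MedialSubdivision.Triangle κ → ℝ,
      (∀ T, 0 < l T ∧ 0 < L T) ∧
      (∀ t : ℕ → MedialSubdivision.Triangle κ, MedialSubdivision.IsNested t →
        (∀ n : ℕ,
          (t 0).height * l (t 0) ≤ 2 ^ n * (t n).height ∧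
            2 ^ n * (t n).height ≤ (t 0).height * L (t 0)) ∧
        ((∃ m : ℕ, MedialSubdivision.ParallelSideA (t m) (t (m + 1))) →
          ∀ n : ℕ,
            (t 0).height * l (t 0) < 2 ^ n * (t n).height ∧
              2 ^ n * (t n).height < (t 0).height * L (t 0))) ∧
      Tendsto l (MedialSubdivision.sidesToZero κ) (𝓝[<] 1) ∧
      Tendsto L (MedialSubdivision.sidesToZero κ) (𝓝[>] 1) := by
  obtain ⟨l, L, h1, h2, h3, h4⟩ := MedialSubdivision.exists_strict_bounds κ
  exact ⟨l, L, h1, fun t ht => ⟨fun n => ⟨(h2 t ht n).1.le, (h2 t ht n).2.le⟩,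
    fun _ => h2 t ht⟩, h3, h4⟩
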